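/- Let $K$ be a field of characteristic different from $2$, and let $\mathrm{SAlg}_K$ be the category of commutative $K$-superalgebras ($\mathbb Z/2$-graded algebras with $ab=(-1)^{|a||b|}ba$ for homogeneous $a,b$) with even morphisms. A $K$-functor is a functor from $\mathrm{SAlg}_K$ to sets, and for $R\in\mathrm{SAlg}_K$ we write $SSp\,R=\mathrm{Hom}_{\mathrm{SAlg}_K}(R,-)$. A finite family of morphisms $R\to R_1,\dots,R\to R_n$ in $\mathrm{SAlg}_K$ is an ff-covering if $R_1\times\dots\times R_n$ is a faithfully flat $R$-supermodule, and an fppf-covering if moreover every $R_i$ is a finitely presented $R$-superalgebra. A $K$-functor $X$ is a dur $K$-sheaf (respectively a $K$-sheaf) if for every ff-covering (respectively every fppf-covering) the diagram $X(R)\to\prod_i X(R_i)\rightrightarrows\prod_{i,j}X(R_i\otimes_R R_j)$ is exact. Let $G$ be a finite supergroup over $K$, that is, a group $K$-functor $G=SSp\,K[G]$ with $\dim_K K[G]<\infty$, and let $H\le G$ be a closed supersubgroup. Let $K[G]^H\subseteq K[G]$ be the supersubalgebra of all $a\in K[G]$ that are invariant under right translation by $H$, i.e. $a(gh)=a(g)$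 for all $A\in\mathrm{SAlg}_K$, $g\in G(A)$, $h\in H(A)$. Let $(G/H)_{(n)}$ be the $K$-functor $A\mapsto G(A)/H(A)$ of cosets $gH(A)$. Theorem 7.1. The canonical morphism $(G/H)_{(n)}\to SSp\,K[G]^H$, $gH(A)\mapsto g|_{K[G]^H}$, makes $SSp\,K[G]^H$ the dur $K$-sheaf associated with $(G/H)_{(n)}$, and it also makes it the $K$-sheaf associated with $(G/H)_{(n)}$. In other words, $SSp\,K[G]^H$ is a dur $K$-sheaf (and hence a $K$-sheaf), and every morphism from $(G/H)_{(n)}$ to a dur $K$-sheaf, or to a $K$-sheaf, factors uniquely through $(G/H)_{(n)}\to SSp\,K[G]^H$. Thus the quotient dur $K$-sheaf $\tilde{\tilde{G/H}}$ is affine, equals $SSp\,K[G]^H$, and coincides with the quotient $K$-sheaf $\tilde{G/H}$. -/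

import Mathlib

open CategoryTheory

universe w u

noncomputable section

/-! ### Commutative superalgebras -/

/-- The category of commutative `K`-superalgebras: `ℤ/2`-graded associative unital
`K`-algebras `A = A₀ ⊕ A₁` with `ab = (-1)^{|a||b|} ba` for homogeneous `a, b`. -/
structure SAlg (K : Type u) [Field K] where
  carrier : Type u
  [ring : Ring carrier]
  [algebra : Algebra K carrier]
  grading : ZMod 2 → Submodule K carrier
  [graded : GradedAlgebra grading]
  supercomm : ∀ (i j : ZMod 2) (a b : carrier), a ∈ grading i → b ∈ grading j →
    a * b = (-1) ^ (i * j).val * (b * a)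

attribute [instance] SAlg.ring SAlg.algebra SAlg.graded

namespace SAlg

variable {K : Type u} [Field K]

instance : CoeSort (SAlg.{u} K) (Type u) := ⟨SAlg.carrier⟩

/-- Morphisms of superalgebras: even (that is, degree-preserving) algebra homomorphisms. -/
@[ext]
structure Hom (A B : SAlg.{u} K) where
  toAlgHom : A →ₐ[K] B
  map_mem : ∀ (i : ZMod 2) (a : A), a ∈ A.grading i → toAlgHom a ∈ B.grading i

instance : Category.{u} (SAlg.{u} K) where
  Hom := Hom
  id A := ⟨AlgHom.id K A, fun _ _ h => h⟩
  comp f g := ⟨g.toAlgHom.comp f.toAlgHom,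
    fun i a h => g.map_mem i _ (f.map_mem i a h)⟩

/-- The homogeneous component of degree `i` of an element. -/
def component (A : SAlg.{u} K) (i : ZMod 2) (a : A) : A :=
  (DirectSum.decompose A.grading a i : A)

theorem hom_component {A B : SAlg.{u} K} (f : A ⟶ B) (i : ZMod 2) (a : A) :
    f.toAlgHom (A.component i a) = B.component i (f.toAlgHom a) := by
  have key : ∀ (j : ZMod 2) (x : A), x ∈ A.grading j →
      f.toAlgHom (A.component i x) = B.component i (f.toAlgHom x) := by
    intro j x hx
    have hfx := f.map_mem j x hx
    by_cases hij : j = i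
    · subst hij
      simp only [component]
      rw [DirectSum.decompose_of_mem_same _ hx, DirectSum.decompose_of_mem_same _ hfx]
    · simp only [component]
      rw [DirectSum.decompose_of_mem_ne _ hx hij, DirectSum.decompose_of_mem_ne _ hfx hij,
        map_zero]
  induction a using DirectSum.Decomposition.inductionOn A.grading with
  | zero => simp [component]
  | homogeneous x => exact key _ _ x.2
  | add x y hx hy =>
    simp only [component, DirectSum.decompose_add, DirectSum.add_apply, Submodule.coe_add,
      map_add] at hx hy ⊢
    rw [hx, hy]

theorem sum_component (A : SAlg.{u} K) (a : A) : ∑ i, A.component i a = a := by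
  classical
  conv_rhs => rw [← DirectSum.sum_support_decompose A.grading a]
  refine (Finset.sum_subset (Finset.subset_univ _) ?_).symm
  intro i _ hi
  simpa [component] using hi

/-- A subalgebra that contains the homogeneous components of its elements, as a commutative
superalgebra with the induced grading. -/
def ofSubalgebra (A : SAlg.{u} K) (S : Subalgebra K A)
    (hS : ∀ a ∈ S, ∀ i, A.component i a ∈ S) : SAlg.{u} K :=
  let gr : ZMod 2 → Submodule K S := fun i => (A.grading i).comap S.val.toLinearMap
  let toComp : ∀ i, S →ₗ[K] gr i := fun i =>
    { toFun := fun a => ⟨⟨A.component i a, hS a a.2 i⟩, (DirectSum.decompose A.grading a.1 i).2⟩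
      map_add' := fun a b => by
        apply Subtype.ext; apply Subtype.ext
        simp [component, DirectSum.decompose_add]
      map_smul' := fun c a => by
        apply Subtype.ext; apply Subtype.ext
        simp only [component, SetLike.val_smul, DirectSum.decompose_smul]
        rfl }
  letI : SetLike.GradedMonoid gr :=
    { one_mem := SetLike.GradedOne.one_mem (A := A.grading)
      mul_mem := fun _ _ _ _ ha hb => SetLike.GradedMul.mul_mem (A := A.grading) ha hb }
  letI : DirectSum.Decomposition gr := DirectSum.Decomposition.ofLinearMap gr
    (∑ i, (DirectSum.lof K (ZMod 2) (fun i => gr i) i) ∘ₗ toComp i)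
    (by
      ext a
      rw [LinearMap.comp_apply, LinearMap.sum_apply, map_sum]
      simp only [LinearMap.comp_apply, DirectSum.coeLinearMap_lof, LinearMap.id_apply]
      rw [AddSubmonoidClass.coe_finsetSum]
      exact A.sum_component a)
    (by
      ext i x : 2
      have hx : (x : S).1 ∈ A.grading i := x.2
      rw [LinearMap.comp_apply, LinearMap.comp_apply, DirectSum.coeLinearMap_lof,
        LinearMap.sum_apply, LinearMap.comp_apply, LinearMap.id_apply]
      rw [Finset.sum_eq_single i]
      · rw [LinearMap.comp_apply]
        congr 1
        apply Subtype.ext; apply Subtype.ext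
        exact DirectSum.decompose_of_mem_same _ hx
      · intro j _ hj
        rw [LinearMap.comp_apply]
        have : toComp j (x : S) = 0 := by
          apply Subtype.ext; apply Subtype.ext
          exact DirectSum.decompose_of_mem_ne _ hx hj.symm
        rw [this, map_zero]
      · intro h
        exact absurd (Finset.mem_univ i) h)
  { carrier := S
    grading := gr
    graded := { }
    supercomm := fun i j a b ha hb => by
      apply Subtype.ext
      simpa using A.supercomm i j a b ha hb }

/-- The inclusion of a graded subalgebra. -/
def ofSubalgebraIncl (A : SAlg.{u} K) (S : Subalgebra K A)
    (hS : ∀ a ∈ S, ∀ i, A.component i a ∈ S) : A.ofSubalgebra S hS ⟶ A :=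
  Hom.mk (A := A.ofSubalgebra S hS) (B := A) S.val (fun _ _ h => h)

/-- The affine superscheme `SSp A`, the `K`-functor `B ↦ Hom(A, B)`. -/
abbrev SSp (A : SAlg.{u} K) : SAlg.{u} K ⥤ Type u := coyoneda.obj (Opposite.op A)

end SAlg

variable {K : Type u} [Field K]

/-! ### Supermodules and faithful flatness -/

/-- Left supermodules over a commutative superalgebra. -/
structure SMod (A : SAlg.{u} K) where
  carrier : Type u
  [addCommGroup : AddCommGroup carrier]
  [moduleK : Module K carrier]
  [module : Module A carrier]
  [tower : IsScalarTower K A carrier]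
  grading : ZMod 2 → Submodule K carrier
  [decomposition : DirectSum.Decomposition grading]
  smul_mem : ∀ (i j : ZMod 2) (a : A) (x : carrier), a ∈ A.grading i → x ∈ grading j →
    a • x ∈ grading (i + j)

attribute [instance] SMod.addCommGroup SMod.moduleK SMod.module SMod.tower SMod.decomposition

instance (A : SAlg.{u} K) : CoeSort (SMod A) (Type u) := ⟨SMod.carrier⟩

/-- Even morphisms of supermodules. -/
structure SMod.Hom {A : SAlg.{u} K} (M N : SMod A) where
  toLinearMap : M →ₗ[A] N
  map_mem : ∀ (i : ZMod 2) (x : M), x ∈ M.grading i → toLinearMap x ∈ N.grading i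

section BaseChange

variable {A : SAlg.{u} K} {B : Type u} [Ring B] [Algebra K B] (φ : A →ₐ[K] B)

/-- The relations `b φ(a) ⊗ m = b ⊗ a m` that define `B ⊗_A M` as a quotient of `B ⊗_K M`. -/
def baseChangeRel (M : SMod A) : Submodule K (TensorProduct K B M) :=
  Submodule.span K {t | ∃ (b : B) (a : A) (m : M),
    t = (b * φ a) ⊗ₜ[K] m - b ⊗ₜ[K] (a • m)}

/-- The tensor product `B ⊗_A M`, where `B` is a right `A`-module through `φ : A → B`. -/
abbrev BaseChange (M : SMod A) : Type u := TensorProduct K B M ⧸ baseChangeRel φ M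

/-- The map `id ⊗ f : B ⊗_A M → B ⊗_A N`. -/
def baseChangeMap {M N : SMod A} (f : SMod.Hom M N) : BaseChange φ M →ₗ[K] BaseChange φ N :=
  Submodule.mapQ _ _ (TensorProduct.map LinearMap.id (f.toLinearMap.restrictScalars K)) (by
    rw [baseChangeRel, Submodule.span_le]
    rintro _ ⟨b, a, m, rfl⟩
    refine Submodule.subset_span ⟨b, a, f.toLinearMap m, ?_⟩
    simp)

/-- `B` is a faithfully flat right `A`-supermodule: a sequence `M' → M → M''` of left
`A`-supermodules is exact if and only if `B ⊗_A M' → B ⊗_A M → B ⊗_A M''` is. (Exactness does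
not involve the grading of the tensor product.) -/
def IsFaithfullyFlat : Prop :=
  ∀ (M' M M'' : SMod A) (f : SMod.Hom M' M) (g : SMod.Hom M M''),
    Function.Exact f.toLinearMap g.toLinearMap ↔
      Function.Exact (baseChangeMap φ f) (baseChangeMap φ g)

end BaseChange

/-! ### Finitely presented superalgebras -/

/-- `κ : R → P` with `t₁, …, t_m` and `z₁, …, z_n` is the free commutative `R`-superalgebra
`R[m|n]` on `m` even and `n` odd generators. -/
structure IsFreeSuperalgebra {R P : SAlg.{u} K} (κ : R ⟶ P) {m n : ℕ}
    (t : Fin m → P) (z : Fin n → P) : Prop where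
  even : ∀ i, t i ∈ P.grading 0
  odd : ∀ j, z j ∈ P.grading 1
  existsUnique_lift : ∀ (S : SAlg.{u} K) (f : R ⟶ S) (a : Fin m → S) (b : Fin n → S),
    (∀ i, a i ∈ S.grading 0) → (∀ j, b j ∈ S.grading 1) →
    ∃! g : P ⟶ S, κ ≫ g = f ∧ (∀ i, g.toAlgHom (t i) = a i) ∧ ∀ j, g.toAlgHom (z j) = b j

/-- `S ≃ R[m|n]/I` as `R`-superalgebras, for some `m, n` and some finitely generated superideal
`I`. (The kernel of a morphism of superalgebras is a superideal, and for a superideal it is the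
same to be finitely generated as a left or as a two-sided ideal.) -/
def IsFinitelyPresented {R S : SAlg.{u} K} (ι : R ⟶ S) : Prop :=
  ∃ (m n : ℕ) (P : SAlg.{u} K) (κ : R ⟶ P) (t : Fin m → P) (z : Fin n → P) (π : P ⟶ S),
    IsFreeSuperalgebra κ t z ∧ κ ≫ π = ι ∧ Function.Surjective π.toAlgHom ∧
      (RingHom.ker π.toAlgHom).FG

/-! ### Coverings, (dur) `K`-sheafs and associated sheafs -/

/-- A notion of covering of `R` by a finite family of `R`-superalgebras `R → S₁, …, R → S_n`. -/
abbrev Coverings (K : Type u) [Field K] : Type (u + 1) :=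
  ∀ (R : SAlg.{u} K) (n : ℕ) (S : Fin n → SAlg.{u} K), (∀ i, R ⟶ S i) → Prop

/-- Faithfully flat coverings: `S₁ × ⋯ × S_n` is a faithfully flat `R`-supermodule. -/
def ffCoverings : Coverings K := fun R _ S ι =>
  IsFaithfullyFlat (A := R) (B := ∀ i, S i) (AlgHom.pi fun i => (ι i).toAlgHom)

/-- Fppf-coverings: faithfully flat coverings by finitely presented superalgebras. -/
def fppfCoverings : Coverings K := fun R n S ι =>
  ffCoverings R n S ι ∧ ∀ i, IsFinitelyPresented (ι i)

/-- The sheaf condition: for each covering, `X(R) → ∏ X(Sᵢ) ⇉ ∏ X(Sᵢ ⊗_R Sⱼ)` is exact.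
As `Sᵢ ⊗_R Sⱼ` is the pushout of `Sᵢ ← R → Sⱼ`, two elements of `X(Sᵢ)` and `X(Sⱼ)` have the same
image in `X(Sᵢ ⊗_R Sⱼ)` iff they have the same image in `X(T)` for all `Sᵢ → T ← Sⱼ` that agree
on `R`. -/
def IsSheafFor (Cov : Coverings K) (X : SAlg.{u} K ⥤ Type w) : Prop :=
  ∀ (R : SAlg.{u} K) (n : ℕ) (S : Fin n → SAlg.{u} K) (ι : ∀ i, R ⟶ S i), Cov R n S ι →
    ∀ x : ∀ i, X.obj (S i),
      (∀ (i j : Fin n) (T : SAlg.{u} K) (a : S i ⟶ T) (b : S j ⟶ T),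
        ι i ≫ a = ι j ≫ b → X.map a (x i) = X.map b (x j)) →
      ∃! y : X.obj R, ∀ i, X.map (ι i) y = x i

/-- `α : X → Y` makes `Y` the sheaf associated with the `K`-functor `X`: `Y` is a sheaf and
composition with `α` is a bijection `Mor(Y, Z) → Mor(X, Z)` for every sheaf `Z`, where `Z` may take
values in a larger universe than `X` and `Y`. -/
structure IsAssociatedSheaf (Cov : Coverings K) {X Y : SAlg.{u} K ⥤ Type u} (α : X ⟶ Y) :
    Prop where
  isSheaf : IsSheafFor Cov Y
  bijective : ∀ Z : SAlg.{u} K ⥤ Type (max u w), IsSheafFor Cov Z →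
    Function.Bijective fun v : (Y ⋙ uliftFunctor.{w, u} ⟶ Z) =>
      Functor.whiskerRight α uliftFunctor.{w, u} ≫ v

/-! ### Affine supergroups and their quotients -/

/-- An affine supergroup `G`: a commutative superalgebra `K[G]` with a group structure on
`G(B) = Hom(K[G], B)` for every `B`, natural in `B`. -/
structure AffineSupergroup (K : Type u) [Field K] where
  coord : SAlg.{u} K
  group : ∀ B : SAlg.{u} K, Group (coord ⟶ B)
  mul_comp : ∀ {B C : SAlg.{u} K} (g h : coord ⟶ B) (f : B ⟶ C), (g * h) ≫ f = (g ≫ f) * (h ≫ f)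

namespace AffineSupergroup

instance (G : AffineSupergroup.{u} K) (B : SAlg.{u} K) : Group (G.coord ⟶ B) := G.group B

/-- The group homomorphism `G(f) : G(B) → G(C)` for `f : B → C`. -/
def mapHom (G : AffineSupergroup.{u} K) {B C : SAlg.{u} K} (f : B ⟶ C) :
    (G.coord ⟶ B) →* (G.coord ⟶ C) :=
  MonoidHom.mk' (fun g => g ≫ f) fun g h => G.mul_comp g h f

/-- A finite supergroup is an affine supergroup with finite-dimensional `K[G]`. -/
def IsFinite (G : AffineSupergroup.{u} K) : Prop := FiniteDimensional K G.coord

/-- A closed supersubgroup `H ≤ G`: a superideal `I_H` of `K[G]` (a homogeneous left ideal; it is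
automatically two-sided) such that `H(B) = V(I_H)(B) = {g ∈ G(B) | g(I_H) = 0}` is a subgroup of
`G(B)` for every `B`. -/
structure ClosedSubgroup (G : AffineSupergroup.{u} K) where
  ideal : Ideal G.coord
  homogeneous : ∀ a ∈ ideal, ∀ i, G.coord.component i a ∈ ideal
  one_mem : ∀ (B : SAlg.{u} K), ∀ a ∈ ideal, (1 : G.coord ⟶ B).toAlgHom a = 0
  mul_mem : ∀ (B : SAlg.{u} K) (g h : G.coord ⟶ B), (∀ a ∈ ideal, g.toAlgHom a = 0) →
    (∀ a ∈ ideal, h.toAlgHom a = 0) → ∀ a ∈ ideal, (g * h).toAlgHom a = 0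
  inv_mem : ∀ (B : SAlg.{u} K) (g : G.coord ⟶ B), (∀ a ∈ ideal, g.toAlgHom a = 0) →
    ∀ a ∈ ideal, (g⁻¹).toAlgHom a = 0

namespace ClosedSubgroup

variable {G : AffineSupergroup.{u} K} (H : G.ClosedSubgroup)

/-- The subgroup `H(B)` of `G(B)`. -/
def points (B : SAlg.{u} K) : Subgroup (G.coord ⟶ B) where
  carrier := {g | ∀ a ∈ H.ideal, g.toAlgHom a = 0}
  one_mem' := H.one_mem B
  mul_mem' := fun {g h} hg hh => H.mul_mem B g h hg hh
  inv_mem' := fun {g} hg => H.inv_mem B g hg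

theorem map_mem_points {B C : SAlg.{u} K} (f : B ⟶ C) {g : G.coord ⟶ B} (hg : g ∈ H.points B) :
    G.mapHom f g ∈ H.points C := fun a ha => by
  change f.toAlgHom (g.toAlgHom a) = 0
  rw [hg a ha, map_zero]

/-- The naive quotient `(G/H)_(n)`, the `K`-functor `B ↦ G(B)/H(B)` of cosets `gH(B)`. -/
def naiveQuotient : SAlg.{u} K ⥤ Type u where
  obj B := (G.coord ⟶ B) ⧸ H.points B
  map {B C} f := TypeCat.ofHom (Quotient.map' (G.mapHom f) fun g g' h => by
    rw [QuotientGroup.leftRel_apply] at h ⊢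
    rw [← map_inv, ← map_mul]
    exact H.map_mem_points f h)
  map_id B := by
    ext x
    induction x using QuotientGroup.induction_on with
    | H g => exact congrArg (QuotientGroup.mk (s := H.points B)) (Category.comp_id g)
  map_comp {B C D} f f' := by
    ext x
    induction x using QuotientGroup.induction_on with
    | H g => exact congrArg (QuotientGroup.mk (s := H.points D)) (Category.assoc g f f').symm

/-- The algebra `K[G]^H` of right `H`-invariant functions on `G`: those `a` with `a(gh) = a(g)`
for all `g ∈ G(B)`, `h ∈ H(B)` and all `B`, where `a(g) = g(a)`. -/
def invariantSubalgebra : Subalgebra K G.coord where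
  carrier := {a | ∀ (B : SAlg.{u} K) (g h : G.coord ⟶ B), h ∈ H.points B →
    (g * h).toAlgHom a = g.toAlgHom a}
  mul_mem' := fun {a b} ha hb B g h hh => by
    rw [map_mul, map_mul, ha B g h hh, hb B g h hh]
  add_mem' := fun {a b} ha hb B g h hh => by
    rw [map_add, map_add, ha B g h hh, hb B g h hh]
  algebraMap_mem' := fun c B g h _ => by
    rw [AlgHom.commutes, AlgHom.commutes]

theorem component_mem_invariantSubalgebra (a : G.coord) (ha : a ∈ H.invariantSubalgebra)
    (i : ZMod 2) : G.coord.component i a ∈ H.invariantSubalgebra := fun B g h hh => by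
  rw [SAlg.hom_component, SAlg.hom_component, ha B g h hh]

/-- `K[G]^H` as a commutative superalgebra. -/
def invariants : SAlg.{u} K :=
  G.coord.ofSubalgebra H.invariantSubalgebra H.component_mem_invariantSubalgebra

/-- The inclusion `K[G]^H → K[G]`. -/
def invariantsIncl : H.invariants ⟶ G.coord :=
  G.coord.ofSubalgebraIncl H.invariantSubalgebra H.component_mem_invariantSubalgebra

/-- The canonical morphism from the naive quotient of `G` by `H` to `SSp K[G]^H`, which sends
the coset of `g : K[G] → B` to the restriction of `g` to `K[G]^H`. -/
def quotientMap : H.naiveQuotient ⟶ H.invariants.SSp where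
  app B := TypeCat.ofHom fun x => Quotient.liftOn' x (fun g => H.invariantsIncl ≫ g) (by
    intro g g' h
    rw [QuotientGroup.leftRel_apply] at h
    apply SAlg.Hom.ext
    apply AlgHom.ext
    intro a
    have h1 := a.2 B g (g⁻¹ * g') h
    rw [mul_inv_cancel_left] at h1
    exact h1.symm)
  naturality B C f := by
    ext x
    induction x using QuotientGroup.induction_on with
    | H g => exact (Category.assoc H.invariantsIncl g f).symm

end ClosedSubgroup

end AffineSupergroup

end

noncomputable section

variable {K : Type u} [Field K]

namespace SAlg

/-! ### Signs and the parity automorphism -/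

/-! Every `SSp A` is a dur sheaf by faithfully flat descent (`isSheafFor_SSp`). By a Yoneda argument
(`isAssociatedSheaf_quotientMap`) the theorem then reduces to two facts: K[G]^H → K[G] is a
covering, and two points of G with the same restriction to K[G]^H lie in the same coset of H.

Both facts come from averaging over H. Let (e_j) be a homogeneous basis of K[H] with dual basis
(e^j), and let ∫_j w be the supertrace of the endomorphism c ↦ c₁ e^j(c₂) w of K[H]. Since c ↦ c₁
e^j(c₂) commutes with left translations and the supertrace is cyclic (`supertrace_comm`), each ∫_j
is translation invariant (`integral_twist`). Since c₁ S(c₂) = ε(c), the sum of the ∫_j S(e_j) w is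
the supertrace of c ↦ ε(c) w, which is ε(w) (`sum_integral_antipode`).

Apply this to w(h) = a(gh). The functions ∫_j a(gh) of g are H-invariant, and the ∫_j S(e_j)(h)
a(gh) add up to a(g). As h = g⁻¹(gh), each S(e_j)(h) is a finite sum of products x(g) y(gh). Pulling
x(g) out of the integral gives a finite dual basis of K[G] as a right K[G]^H-module
(`exists_dualBasis`).

Consequences. If g and g' agree on K[G]^H, the dual basis gives a right T-linear map Θ with Θ(x(gh))
= x(g'), whence Θ(x(h)) = x(g⁻¹g'); so g⁻¹g' kills I_H (`inv_mul_mem_points`). A Nakayama argument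
over the even part makes K[G]^H a direct summand of the finite projective module K[G]
(`exists_retraction`), so K[G] is faithfully flat. Finite presentation is automatic between
finite-dimensional superalgebras.

Characteristic different from 2 lets gradings be replaced by parity involutions, and this is how
tensor products, quotients and free superalgebras are built. -/

theorem zmod_two_cases (i : ZMod 2) : i = 0 ∨ i = 1 := by
  revert i; decide

theorem sum_zmod_two {M : Type*} [AddCommMonoid M] (f : ZMod 2 → M) : ∑ i, f i = f 0 + f 1 :=
  Fin.sum_univ_two (f : Fin 2 → M)

/-- The sign `(-1)^i` in the field `K`. -/
def sg (K : Type u) [Field K] (i : ZMod 2) : K := (-1) ^ i.val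

@[simp] theorem sg_zero : sg K 0 = 1 := by simp [sg]

@[simp] theorem sg_one : sg K 1 = -1 := by simp [sg, ZMod.val_one]

theorem sg_add (i j : ZMod 2) : sg K (i + j) = sg K i * sg K j := by
  rcases zmod_two_cases i with rfl | rfl <;> rcases zmod_two_cases j with rfl | rfl <;>
    simp [show (1 : ZMod 2) + 1 = 0 from rfl]

@[simp] theorem sg_mul_self (i : ZMod 2) : sg K i * sg K i = 1 := by
  rcases zmod_two_cases i with rfl | rfl <;> simp

theorem uzpow_smul_eq_sg {V : Type*} [AddCommGroup V] [Module K V] (i : ZMod 2) (v : V) :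
    ((-1 : ℤˣ) ^ i) • v = sg K i • v := by
  rcases zmod_two_cases i with rfl | rfl <;> simp

theorem zmod_two_add_self (i : ZMod 2) : i + i = 0 := CharTwo.add_self_eq_zero i

theorem supercomm_smul (A : SAlg.{u} K) {i j : ZMod 2} {a b : A} (ha : a ∈ A.grading i)
    (hb : b ∈ A.grading j) : a * b = sg K (i * j) • (b * a) := by
  rw [A.supercomm i j a b ha hb, sg, Algebra.smul_def]
  simp

/-- The projection onto a homogeneous component. -/
def proj (A : SAlg.{u} K) (i : ZMod 2) : A →ₗ[K] A :=
  (A.grading i).subtype ∘ₗ DirectSum.component K (ZMod 2) (fun i => A.grading i) i ∘ₗ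
    (DirectSum.decomposeLinearEquiv A.grading).toLinearMap

theorem proj_apply (A : SAlg.{u} K) (i : ZMod 2) (a : A) : A.proj i a = A.component i a := rfl

theorem component_mem (A : SAlg.{u} K) (i : ZMod 2) (a : A) : A.component i a ∈ A.grading i :=
  (DirectSum.decompose A.grading a i).2

theorem component_of_mem (A : SAlg.{u} K) {i : ZMod 2} {a : A} (ha : a ∈ A.grading i) :
    A.component i a = a := DirectSum.decompose_of_mem_same _ ha

theorem component_of_mem_ne (A : SAlg.{u} K) {i j : ZMod 2} {a : A} (ha : a ∈ A.grading i)
    (h : i ≠ j) : A.component j a = 0 := DirectSum.decompose_of_mem_ne _ ha h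

theorem component_zero_add_one (A : SAlg.{u} K) (a : A) :
    A.component 0 a + A.component 1 a = a := by
  conv_rhs => rw [← A.sum_component a]
  exact (sum_zmod_two (A.component · a)).symm

/-- Induction on the homogeneous components. -/
@[elab_as_elim]
theorem homogeneous_induction (A : SAlg.{u} K) {p : A → Prop}
    (hom : ∀ i, ∀ a ∈ A.grading i, p a) (add : ∀ a b, p a → p b → p (a + b)) (a : A) : p a := by
  rw [← A.component_zero_add_one a]
  exact add _ _ (hom 0 _ (A.component_mem 0 a)) (hom 1 _ (A.component_mem 1 a))

/-- `a ↦ ∑ (-1)^(d|aᵢ|) aᵢ` as a linear map. -/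
def parLin (A : SAlg.{u} K) (d : ZMod 2) : A →ₗ[K] A := ∑ i, sg K (d * i) • A.proj i

theorem parLin_of_mem (A : SAlg.{u} K) (d : ZMod 2) {i : ZMod 2} {a : A} (ha : a ∈ A.grading i) :
    A.parLin d a = sg K (d * i) • a := by
  rw [parLin, LinearMap.sum_apply, Finset.sum_eq_single i]
  · rw [LinearMap.smul_apply, proj_apply, A.component_of_mem ha]
  · intro j _ hj
    rw [LinearMap.smul_apply, proj_apply, A.component_of_mem_ne ha hj.symm, smul_zero]
  · simp

/-- The `d`-th power of the parity automorphism `a ↦ (-1)^|a| a`. -/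
def par (A : SAlg.{u} K) (d : ZMod 2) : A ⟶ A where
  toAlgHom := AlgHom.ofLinearMap (A.parLin d)
    (by rw [A.parLin_of_mem d (SetLike.GradedOne.one_mem (A := A.grading))]; simp)
    (by
      intro x y
      induction x using A.homogeneous_induction with
      | hom i x hx =>
        induction y using A.homogeneous_induction with
        | hom j y hy =>
          rw [A.parLin_of_mem d (SetLike.GradedMul.mul_mem hx hy), A.parLin_of_mem d hx,
            A.parLin_of_mem d hy, mul_add, sg_add, smul_mul_smul_comm]
        | add y z hy hz => rw [mul_add, map_add, map_add, hy, hz, mul_add]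
      | add x z hx hz => rw [add_mul, map_add, map_add, hx, hz, add_mul])
  map_mem i a ha := by
    change A.parLin d a ∈ _
    rw [A.parLin_of_mem d ha]
    exact Submodule.smul_mem _ _ ha

theorem par_of_mem (A : SAlg.{u} K) (d : ZMod 2) {i : ZMod 2} {a : A} (ha : a ∈ A.grading i) :
    (A.par d).toAlgHom a = sg K (d * i) • a := A.parLin_of_mem d ha

theorem par_one_of_mem (A : SAlg.{u} K) {i : ZMod 2} {a : A} (ha : a ∈ A.grading i) :
    (A.par 1).toAlgHom a = sg K i • a := by rw [A.par_of_mem 1 ha, one_mul]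

@[simp] theorem par_zero (A : SAlg.{u} K) (a : A) : (A.par 0).toAlgHom a = a := by
  induction a using A.homogeneous_induction with
  | hom i a ha => rw [A.par_of_mem 0 ha]; simp
  | add a b ha hb => rw [map_add, ha, hb]

theorem par_par (A : SAlg.{u} K) (d e : ZMod 2) (a : A) :
    (A.par d).toAlgHom ((A.par e).toAlgHom a) = (A.par (d + e)).toAlgHom a := by
  induction a using A.homogeneous_induction with
  | hom i a ha =>
    rw [A.par_of_mem e ha, map_smul, A.par_of_mem d ha, A.par_of_mem _ ha, smul_smul, add_mul,
      sg_add, mul_comm]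
  | add a b ha hb => simp only [map_add, ha, hb]

@[simp] theorem par_self (A : SAlg.{u} K) (d : ZMod 2) (a : A) :
    (A.par d).toAlgHom ((A.par d).toAlgHom a) = a := by
  rw [par_par, zmod_two_add_self, par_zero]

theorem hom_par {A B : SAlg.{u} K} (f : A ⟶ B) (d : ZMod 2) (a : A) :
    f.toAlgHom ((A.par d).toAlgHom a) = (B.par d).toAlgHom (f.toAlgHom a) := by
  induction a using A.homogeneous_induction with
  | hom i a ha => rw [A.par_of_mem d ha, map_smul, B.par_of_mem d (f.map_mem i a ha)]
  | add a b ha hb => simp only [map_add, ha, hb]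

theorem mul_eq_par_mul (A : SAlg.{u} K) {i : ZMod 2} {a : A} (ha : a ∈ A.grading i) (b : A) :
    a * b = (A.par i).toAlgHom b * a := by
  induction b using A.homogeneous_induction with
  | hom j b hb => rw [A.supercomm_smul ha hb, A.par_of_mem i hb, smul_mul_assoc]
  | add b c hb hc => rw [mul_add, map_add, add_mul, hb, hc]

theorem mul_eq_mul_par (A : SAlg.{u} K) {i : ZMod 2} {a : A} (ha : a ∈ A.grading i) (b : A) :
    b * a = a * (A.par i).toAlgHom b := by
  rw [A.mul_eq_par_mul ha, par_self]

/-- The identity that expresses supercommutativity without reference to homogeneous elements. -/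
theorem two_smul_mul (A : SAlg.{u} K) (a b : A) :
    (2 : K) • (a * b) = b * a + (A.par 1).toAlgHom b * a + b * (A.par 1).toAlgHom a
      - (A.par 1).toAlgHom b * (A.par 1).toAlgHom a := by
  induction a using A.homogeneous_induction with
  | hom i a ha =>
    induction b using A.homogeneous_induction with
    | hom j b hb =>
      rw [A.par_one_of_mem ha, A.par_one_of_mem hb, A.supercomm_smul ha hb]
      rcases zmod_two_cases i with rfl | rfl <;> rcases zmod_two_cases j with rfl | rfl <;>
        simp [two_smul, sub_eq_add_neg]
    | add b c hb hc =>
      simp only [mul_add, map_add, add_mul, smul_add, hb, hc]; abel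
  | add b c hb hc =>
    simp only [mul_add, map_add, add_mul, smul_add, hb, hc]; abel

/-- The grading by the eigenspaces of an involution. -/
def eigenGrading {R : Type u} [Ring R] [Algebra K R] (σ : R →ₐ[K] R) (i : ZMod 2) :
    Submodule K R := LinearMap.eqLocus σ.toLinearMap (sg K i • LinearMap.id)

theorem mem_eigenGrading {R : Type u} [Ring R] [Algebra K R] (σ : R →ₐ[K] R) (i : ZMod 2)
    (a : R) : a ∈ eigenGrading σ i ↔ σ a = sg K i • a := Iff.rfl

section OfInvolution

variable [NeZero (2 : K)]

/-- With 2 invertible, the grading is the eigenspace decomposition of the parity automorphism. A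
superalgebra can therefore be given by an involution, and an even morphism is an algebra map that
commutes with parity. -/
theorem mem_grading_iff (A : SAlg.{u} K) (i : ZMod 2) (a : A) :
    a ∈ A.grading i ↔ (A.par 1).toAlgHom a = sg K i • a := by
  refine ⟨A.par_one_of_mem, fun h => ?_⟩
  have h2 : (2 : K) ≠ 0 := NeZero.ne 2
  have e := A.component_zero_add_one a
  rw [← e, map_add, A.par_one_of_mem (A.component_mem 0 a),
    A.par_one_of_mem (A.component_mem 1 a)] at h
  rcases zmod_two_cases i with rfl | rfl
  · have : (2 : K) • A.component 1 a = 0 := by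
      simp only [sg_zero, sg_one, one_smul, neg_smul, add_right_inj] at h
      rw [two_smul]; nth_rw 1 [← h]; simp
    rw [smul_eq_zero_iff_right h2] at this
    rw [← e, this, add_zero]
    exact A.component_mem 0 a
  · have : (2 : K) • A.component 0 a = 0 := by
      simp only [sg_zero, sg_one, one_smul, neg_smul, neg_add_rev] at h
      rw [add_comm, add_right_inj] at h
      rw [two_smul]; nth_rw 1 [h]; simp
    rw [smul_eq_zero_iff_right h2] at this
    rw [← e, this, zero_add]
    exact A.component_mem 1 a

/-- An even morphism from an algebra morphism that commutes with the parity automorphisms. -/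
def homOfPar {A B : SAlg.{u} K} (f : A →ₐ[K] B)
    (hf : ∀ a, f ((A.par 1).toAlgHom a) = (B.par 1).toAlgHom (f a)) : A ⟶ B where
  toAlgHom := f
  map_mem i a ha := by
    rw [mem_grading_iff] at ha ⊢
    rw [← hf, ha, map_smul]

/-- A commutative superalgebra from an algebra with an involution. -/
def ofInvolution (R : Type u) [Ring R] [Algebra K R] (σ : R →ₐ[K] R)
    (hσ : ∀ a, σ (σ a) = a)
    (hc : ∀ a b : R, (2 : K) • (a * b) = b * a + σ b * a + b * σ a - σ b * σ a) : SAlg.{u} K :=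
  let toComp : ∀ i, R →ₗ[K] eigenGrading σ i := fun i =>
    LinearMap.codRestrict (eigenGrading σ i)
      ((2 : K)⁻¹ • (LinearMap.id + sg K i • σ.toLinearMap)) fun a => by
        rw [mem_eigenGrading]
        simp only [LinearMap.smul_apply, LinearMap.add_apply, LinearMap.id_apply,
          AlgHom.toLinearMap_apply, map_smul, map_add, hσ, smul_add, smul_smul]
        rw [mul_left_comm, sg_mul_self, mul_one, add_comm, mul_comm]
  have toComp_apply : ∀ i a, (toComp i a : R) = (2 : K)⁻¹ • (a + sg K i • σ a) := fun _ _ => rfl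
  have h2 : (2 : K) ≠ 0 := NeZero.ne 2
  letI : SetLike.GradedMonoid (eigenGrading σ) :=
    { one_mem := by rw [mem_eigenGrading]; simp
      mul_mem := fun i j a b ha hb => by
        rw [mem_eigenGrading] at ha hb ⊢
        rw [map_mul, ha, hb, sg_add, smul_mul_smul_comm] }
  letI : DirectSum.Decomposition (eigenGrading σ) := DirectSum.Decomposition.ofLinearMap _
    (∑ i, (DirectSum.lof K (ZMod 2) (fun i => eigenGrading σ i) i) ∘ₗ toComp i)
    (by
      ext a
      rw [LinearMap.comp_apply, LinearMap.sum_apply, map_sum]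
      simp only [LinearMap.comp_apply, DirectSum.coeLinearMap_lof, LinearMap.id_apply]
      rw [sum_zmod_two, toComp_apply, toComp_apply, ← smul_add]
      rw [sg_zero, sg_one, one_smul, neg_one_smul, add_add_add_comm, add_neg_cancel, add_zero,
        ← two_smul K, smul_smul, inv_mul_cancel₀ h2, one_smul])
    (by
      ext i x : 2
      have hx : σ (x : R) = sg K i • (x : R) := x.2
      have hc : ∀ j, toComp j (x : R) = if h : j = i then h ▸ x else 0 := by
        intro j
        split_ifs with h
        · subst h
          apply Subtype.ext
          rw [toComp_apply, hx, smul_smul, sg_mul_self, one_smul, ← two_smul K, smul_smul,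
            inv_mul_cancel₀ h2, one_smul]
        · apply Subtype.ext
          rw [toComp_apply, hx, smul_smul, ← sg_add]
          have : j + i = 1 := by
            clear hc hx x; revert h; revert i j; decide
          rw [this, sg_one, neg_one_smul, add_neg_cancel, smul_zero]; rfl
      rw [LinearMap.comp_apply, LinearMap.comp_apply, DirectSum.coeLinearMap_lof,
        LinearMap.sum_apply, LinearMap.comp_apply, LinearMap.id_apply]
      rw [Finset.sum_eq_single i]
      · rw [LinearMap.comp_apply, hc, dif_pos rfl]
      · intro j _ hj
        rw [LinearMap.comp_apply, hc, dif_neg hj, map_zero]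
      · intro h
        exact absurd (Finset.mem_univ i) h)
  { carrier := R
    grading := eigenGrading σ
    graded := { }
    supercomm := fun i j a b ha hb => by
      rw [mem_eigenGrading] at ha hb
      -- On eigenvectors the right-hand side becomes `2ba`, or `-2ba` when both are odd; 2 is then
      -- cancelled.
      have h := hc a b
      rw [ha, hb] at h
      refine smul_right_injective R h2 (h.trans ?_)
      rcases zmod_two_cases i with rfl | rfl <;> rcases zmod_two_cases j with rfl | rfl <;>
        simp [two_smul, ZMod.val_one, sub_eq_add_neg] }

theorem ofInvolution_par (R : Type u) [Ring R] [Algebra K R] (σ : R →ₐ[K] R) (hσ hc) (a : R) :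
    ((ofInvolution R σ hσ hc).par 1).toAlgHom a = σ a := by
  induction a using (ofInvolution R σ hσ hc).homogeneous_induction with
  | hom i a ha => rw [par_one_of_mem _ ha]; exact (show σ a = sg K i • a from ha).symm
  | add a b ha hb => exact (map_add _ a b).trans ((congrArg₂ _ ha hb).trans (map_add σ a b).symm)

end OfInvolution

theorem hom_comp_apply {A B C : SAlg.{u} K} (f : A ⟶ B) (g : B ⟶ C) (a : A) :
    (f ≫ g).toAlgHom a = g.toAlgHom (f.toAlgHom a) := rfl

theorem hom_id_apply (A : SAlg.{u} K) (a : A) : (𝟙 A : A ⟶ A).toAlgHom a = a := rfl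

theorem hom_ext {A B : SAlg.{u} K} {f g : A ⟶ B} (h : ∀ a, f.toAlgHom a = g.toAlgHom a) : f = g :=
  Hom.ext (AlgHom.ext h)

end SAlg

namespace SAlg

/-! ### Tensor products over `K` -/

/-- The underlying algebra of the tensor product of superalgebras. -/
abbrev TensorCarrier (S T : SAlg.{u} K) : Type u := GradedTensorProduct K S.grading T.grading

section TensorCarrier

variable (S T : SAlg.{u} K)

theorem tensorCarrier_mul {s s' : S} {t t' : T} {i j : ZMod 2} (ht : t ∈ T.grading j)
    (hs' : s' ∈ S.grading i) :
    (GradedTensorProduct.tmul K s t * GradedTensorProduct.tmul K s' t' : TensorCarrier S T) =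
      sg K (j * i) • GradedTensorProduct.tmul K (s * s') (t * t') := by
  rw [← uzpow_smul_eq_sg (K := K)]
  exact GradedTensorProduct.tmul_coe_mul_coe_tmul S.grading T.grading s ⟨t, ht⟩ ⟨s', hs'⟩ t'

variable {S T}

@[elab_as_elim]
theorem tensorCarrier_induction {p : TensorCarrier S T → Prop}
    (tmul : ∀ i j, ∀ s ∈ S.grading i, ∀ t ∈ T.grading j, p (GradedTensorProduct.tmul K s t))
    (add : ∀ x y, p x → p y → p (x + y)) (x : TensorCarrier S T) : p x := by
  have h0 : p 0 := by
    have := tmul 0 0 0 (zero_mem _) 0 (zero_mem _)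
    rwa [GradedTensorProduct.tmul, TensorProduct.zero_tmul, map_zero] at this
  refine TensorProduct.induction_on (motive := fun z => p (GradedTensorProduct.of K _ _ z))
    ((GradedTensorProduct.of K S.grading T.grading).symm x) ?_ ?_ ?_
  · rwa [map_zero]
  · intro s t
    induction s using S.homogeneous_induction with
    | hom i s hs =>
      induction t using T.homogeneous_induction with
      | hom j t ht => exact tmul i j s hs t ht
      | add t t' h h' => rw [TensorProduct.tmul_add, map_add]; exact add _ _ h h'
    | add s s' h h' => rw [TensorProduct.add_tmul, map_add]; exact add _ _ h h'
  · intro y z hy hz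
    rw [map_add]; exact add _ _ hy hz

/-- The morphism from the tensor product given by two morphisms to a superalgebra. -/
def tensorCarrierLift {R : SAlg.{u} K} (f : S ⟶ R) (g : T ⟶ R) : TensorCarrier S T →ₐ[K] R :=
  GradedTensorProduct.lift _ _ f.toAlgHom g.toAlgHom fun i j a b => by
    rw [uzpow_smul_eq_sg (K := K), mul_comm]
    exact R.supercomm_smul (f.map_mem i _ a.2) (g.map_mem j _ b.2)

variable (S T)

/-- The parity automorphism of the tensor product. -/
def tensorCarrierPar : TensorCarrier S T →ₐ[K] TensorCarrier S T :=
  GradedTensorProduct.lift _ _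
    ((GradedTensorProduct.includeLeft S.grading T.grading).comp (S.par 1).toAlgHom)
    ((GradedTensorProduct.includeRight S.grading T.grading).comp (T.par 1).toAlgHom)
    fun i j a b => by
      rw [uzpow_smul_eq_sg (K := K), AlgHom.comp_apply, AlgHom.comp_apply]
      have ha := (S.par 1).map_mem i _ a.2
      have hb := (T.par 1).map_mem j _ b.2
      rw [GradedTensorProduct.includeLeft_apply, GradedTensorProduct.includeRight_apply,
        tensorCarrier_mul S T hb ha, GradedTensorProduct.tmul_one_mul_one_tmul, one_mul, mul_one,
        smul_smul, sg_mul_self, one_smul]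

theorem tensorCarrierPar_tmul (s : S) (t : T) :
    tensorCarrierPar S T (GradedTensorProduct.tmul K s t) =
      GradedTensorProduct.tmul K ((S.par 1).toAlgHom s) ((T.par 1).toAlgHom t) := by
  rw [tensorCarrierPar, GradedTensorProduct.lift_tmul]
  exact GradedTensorProduct.tmul_one_mul_one_tmul _ _ _ _

theorem tensorCarrierPar_of_mem {i j : ZMod 2} {s : S} {t : T} (hs : s ∈ S.grading i)
    (ht : t ∈ T.grading j) : tensorCarrierPar S T (GradedTensorProduct.tmul K s t) =
      sg K (i + j) • GradedTensorProduct.tmul K s t := by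
  rw [tensorCarrierPar_tmul, S.par_one_of_mem hs, T.par_one_of_mem ht, GradedTensorProduct.tmul,
    TensorProduct.smul_tmul_smul, map_smul, sg_add]

variable [NeZero (2 : K)]

/-- The tensor product of commutative superalgebras over `K`, their coproduct. -/
def tensor : SAlg.{u} K :=
  ofInvolution (TensorCarrier S T) (tensorCarrierPar S T)
    (by
      intro a
      induction a using tensorCarrier_induction with
      | tmul i j s hs t ht =>
        rw [tensorCarrierPar_of_mem S T hs ht, map_smul, tensorCarrierPar_of_mem S T hs ht,
          smul_smul, sg_mul_self, one_smul]
      | add x y hx hy => rw [map_add, map_add, hx, hy])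
    (by
      intro a b
      induction a using tensorCarrier_induction with
      | tmul i j s hs t ht =>
        induction b using tensorCarrier_induction with
        | tmul k l s' hs' t' ht' =>
          rw [tensorCarrierPar_of_mem S T hs ht, tensorCarrierPar_of_mem S T hs' ht']
          simp only [smul_mul_assoc, mul_smul_comm]
          rw [tensorCarrier_mul S T ht hs', tensorCarrier_mul S T ht' hs,
            S.supercomm_smul hs hs', T.supercomm_smul ht ht']
          simp only [GradedTensorProduct.tmul, TensorProduct.smul_tmul_smul, map_smul, smul_smul]
          -- After the commutations all terms are multiples of one tensor, so only signs in the four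
          -- parities remain.
          generalize (GradedTensorProduct.of K S.grading T.grading) _ = z
          rcases zmod_two_cases i with rfl | rfl <;> rcases zmod_two_cases j with rfl | rfl <;>
            rcases zmod_two_cases k with rfl | rfl <;> rcases zmod_two_cases l with rfl | rfl <;>
            simp [two_smul, sub_eq_add_neg, sg_add]
        | add x y hx hy => simp only [mul_add, map_add, add_mul, smul_add, hx, hy]; abel
      | add x y hx hy => simp only [mul_add, map_add, add_mul, smul_add, hx, hy]; abel)

/-- The pure tensors. -/
def tmul : S →ₗ[K] T →ₗ[K] tensor S T :=
  (TensorProduct.mk K S T).compr₂ (GradedTensorProduct.of K S.grading T.grading).toLinearMap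

variable {S T}

@[elab_as_elim]
theorem tensor_induction {p : tensor S T → Prop} (tmul : ∀ s t, p (tmul S T s t))
    (add : ∀ x y, p x → p y → p (x + y)) (x : tensor S T) : p x :=
  tensorCarrier_induction (S := S) (T := T) (p := p) (fun _ _ s _ t _ => tmul s t) add x

theorem par_tmul (s : S) (t : T) : ((tensor S T).par 1).toAlgHom (tmul S T s t) =
    tmul S T ((S.par 1).toAlgHom s) ((T.par 1).toAlgHom t) :=
  (ofInvolution_par _ _ _ _ _).trans (tensorCarrierPar_tmul S T s t)

theorem tmul_mul_tmul (s s' : S) {t : T} (t' : T) {j : ZMod 2} (ht : t ∈ T.grading j) :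
    tmul S T s t * tmul S T s' t' = tmul S T (s * (S.par j).toAlgHom s') (t * t') := by
  induction s' using S.homogeneous_induction with
  | hom i s' hs' =>
    refine (tensorCarrier_mul S T ht hs').trans ?_
    rw [S.par_of_mem j hs', mul_smul_comm, map_smul]
    rfl
  | add x y hx hy => simp only [map_add, LinearMap.add_apply, mul_add, hx, hy]

variable (S T) in
/-- The first inclusion into the tensor product. -/
def inl : S ⟶ tensor S T :=
  homOfPar (GradedTensorProduct.includeLeft S.grading T.grading) fun a => by
    refine Eq.trans ?_ (par_tmul a (1 : T)).symm
    rw [map_one]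
    rfl

variable (S T) in
/-- The second inclusion into the tensor product. -/
def inr : T ⟶ tensor S T :=
  homOfPar (GradedTensorProduct.includeRight S.grading T.grading) fun a => by
    refine Eq.trans ?_ (par_tmul (1 : S) a).symm
    rw [map_one]
    rfl

theorem inl_apply (s : S) : (inl S T).toAlgHom s = tmul S T s 1 := rfl

theorem inr_apply (t : T) : (inr S T).toAlgHom t = tmul S T 1 t := rfl

theorem inl_mul_inr (s : S) (t : T) :
    (inl S T).toAlgHom s * (inr S T).toAlgHom t = tmul S T s t := by
  rw [inl_apply, inr_apply, tmul_mul_tmul _ _ _ (SetLike.GradedOne.one_mem (A := T.grading))]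
  simp

theorem inl_mul_tmul (s s' : S) (t : T) :
    (inl S T).toAlgHom s * tmul S T s' t = tmul S T (s * s') t := by
  rw [← inl_mul_inr s' t, ← mul_assoc, ← map_mul, inl_mul_inr]

/-- The morphism from the tensor product given by a pair of morphisms. -/
def desc {R : SAlg.{u} K} (f : S ⟶ R) (g : T ⟶ R) : tensor S T ⟶ R :=
  homOfPar (A := tensor S T) (tensorCarrierLift f g) fun a => by
    induction a using tensor_induction with
    | tmul s t =>
      rw [par_tmul]
      change f.toAlgHom _ * g.toAlgHom _ = (R.par 1).toAlgHom (f.toAlgHom s * g.toAlgHom t)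
      rw [map_mul, hom_par, hom_par]
    | add x y hx hy =>
      rw [map_add]
      refine (map_add (tensorCarrierLift f g) _ _).trans ?_
      refine (congrArg₂ (· + ·) hx hy).trans ?_
      refine ((R.par 1).toAlgHom.map_add _ _).symm.trans ?_
      exact congrArg _ (map_add (tensorCarrierLift f g) x y).symm

theorem desc_tmul {R : SAlg.{u} K} (f : S ⟶ R) (g : T ⟶ R) (s : S) (t : T) :
    (desc f g).toAlgHom (tmul S T s t) = f.toAlgHom s * g.toAlgHom t := rfl

@[simp]
theorem inl_desc {R : SAlg.{u} K} (f : S ⟶ R) (g : T ⟶ R) : inl S T ≫ desc f g = f :=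
  hom_ext fun a => by rw [hom_comp_apply, inl_apply, desc_tmul, map_one, mul_one]

@[simp]
theorem inr_desc {R : SAlg.{u} K} (f : S ⟶ R) (g : T ⟶ R) : inr S T ≫ desc f g = g :=
  hom_ext fun a => by rw [hom_comp_apply, inr_apply, desc_tmul, map_one, one_mul]

theorem tensor_hom_ext {R : SAlg.{u} K} {f g : tensor S T ⟶ R} (hl : inl S T ≫ f = inl S T ≫ g)
    (hr : inr S T ≫ f = inr S T ≫ g) : f = g := hom_ext fun a => by
  induction a using tensor_induction with
  | tmul s t =>
    have h1 := congrArg (fun h => h.toAlgHom s) hl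
    have h2 := congrArg (fun h => h.toAlgHom t) hr
    simp only [hom_comp_apply] at h1 h2
    rw [← inl_mul_inr, map_mul, map_mul, h1, h2]
  | add x y hx hy => rw [map_add, map_add, hx, hy]

end TensorCarrier

/-! ### Quotients -/

theorem isTwoSided_of_homogeneous (A : SAlg.{u} K) (I : Ideal A)
    (hI : ∀ a ∈ I, ∀ i, A.component i a ∈ I) : I.IsTwoSided := ⟨fun {a} b ha => by
  rw [← A.component_zero_add_one a, add_mul, A.mul_eq_par_mul (A.component_mem 0 a),
    A.mul_eq_par_mul (A.component_mem 1 a)]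
  exact I.add_mem (I.mul_mem_left _ (hI a ha 0)) (I.mul_mem_left _ (hI a ha 1))⟩

theorem par_mem_of_homogeneous (A : SAlg.{u} K) {I : Ideal A}
    (hI : ∀ a ∈ I, ∀ i, A.component i a ∈ I) {a : A} (ha : a ∈ I) (d : ZMod 2) :
    (A.par d).toAlgHom a ∈ I := by
  have h : ∀ i, (A.par d).toAlgHom (A.component i a) ∈ I := fun i => by
    rw [A.par_of_mem d (A.component_mem i a)]
    exact Submodule.smul_of_tower_mem I _ (hI a ha i)
  rw [← A.component_zero_add_one a, map_add]
  exact I.add_mem (h 0) (h 1)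

/-- The parity automorphism of a quotient by a superideal. -/
def quotientPar (A : SAlg.{u} K) (I : Ideal A) [I.IsTwoSided]
    (hI : ∀ a ∈ I, ∀ i, A.component i a ∈ I) : (A ⧸ I) →ₐ[K] (A ⧸ I) :=
  Ideal.Quotient.liftₐ I ((Ideal.Quotient.mkₐ K I).comp (A.par 1).toAlgHom) fun _ ha =>
    Ideal.Quotient.eq_zero_iff_mem.mpr (A.par_mem_of_homogeneous hI ha 1)

variable [NeZero (2 : K)]

/-- The quotient of a commutative superalgebra by a superideal. -/
def quotient (A : SAlg.{u} K) (I : Ideal A) (hI : ∀ a ∈ I, ∀ i, A.component i a ∈ I) :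
    SAlg.{u} K :=
  haveI := A.isTwoSided_of_homogeneous I hI
  ofInvolution (A ⧸ I) (A.quotientPar I hI)
    (fun a => by
      obtain ⟨a, rfl⟩ := Ideal.Quotient.mk_surjective a
      exact congrArg (Ideal.Quotient.mk I) (A.par_self 1 a))
    (fun a b => by
      obtain ⟨a, rfl⟩ := Ideal.Quotient.mk_surjective a
      obtain ⟨b, rfl⟩ := Ideal.Quotient.mk_surjective b
      exact congrArg (Ideal.Quotient.mkₐ K I) (A.two_smul_mul a b))

section Quotient

variable (A : SAlg.{u} K) (I : Ideal A) (hI : ∀ a ∈ I, ∀ i, A.component i a ∈ I)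

/-- The canonical morphism to the quotient. -/
def quotientMk : A ⟶ A.quotient I hI :=
  haveI := A.isTwoSided_of_homogeneous I hI
  homOfPar (B := A.quotient I hI) (Ideal.Quotient.mkₐ K I) fun a =>
    (ofInvolution_par _ (A.quotientPar I hI) _ _ (Ideal.Quotient.mkₐ K I a)).symm

theorem quotientMk_surjective : Function.Surjective (quotientMk A I hI).toAlgHom :=
  haveI := A.isTwoSided_of_homogeneous I hI
  Ideal.Quotient.mk_surjective (I := I)

theorem quotientMk_eq_zero_iff (a : A) : (quotientMk A I hI).toAlgHom a = 0 ↔ a ∈ I :=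
  haveI := A.isTwoSided_of_homogeneous I hI
  Ideal.Quotient.eq_zero_iff_mem

/-- The morphism from a quotient given by a morphism that vanishes on the ideal. -/
def quotientDesc {B : SAlg.{u} K} (f : A ⟶ B) (hf : ∀ a ∈ I, f.toAlgHom a = 0) :
    A.quotient I hI ⟶ B :=
  haveI := A.isTwoSided_of_homogeneous I hI
  homOfPar (A := A.quotient I hI) (Ideal.Quotient.liftₐ I f.toAlgHom hf) fun a => by
    obtain ⟨a, rfl⟩ := quotientMk_surjective A I hI a
    rw [← hom_par]
    exact hom_par f 1 a

variable {A I hI}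

theorem quotient_hom_ext {B : SAlg.{u} K} {f g : A.quotient I hI ⟶ B}
    (h : quotientMk A I hI ≫ f = quotientMk A I hI ≫ g) : f = g := hom_ext fun a => by
  obtain ⟨a, rfl⟩ := quotientMk_surjective A I hI a
  exact congrArg (fun h => h.toAlgHom a) h

end Quotient

/-! ### The initial superalgebra -/

variable (K) in
/-- The field `K` as a superalgebra. -/
def unit : SAlg.{u} K :=
  ofInvolution K (AlgHom.id K K) (fun _ => rfl) fun a b => by
    simp only [AlgHom.id_apply, smul_eq_mul]; ring

/-- The structure morphism from `K`. -/
def unitHom (A : SAlg.{u} K) : unit K ⟶ A :=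
  homOfPar (A := unit K) (Algebra.ofId K A) fun a => by
    rw [show ((unit K).par 1).toAlgHom a = a from ofInvolution_par _ _ _ _ _]
    exact ((A.par 1).toAlgHom.commutes a).symm

theorem eq_zero_of_odd_of_unit {A : SAlg.{u} K} (f : A ⟶ unit K) {a : A} (ha : a ∈ A.grading 1) :
    f.toAlgHom a = 0 := by
  have h : f.toAlgHom a = sg K 1 • f.toAlgHom a := f.map_mem 1 a ha
  rw [sg_one, neg_one_smul, eq_neg_iff_add_eq_zero, ← two_smul K] at h
  exact (smul_eq_zero_iff_right (NeZero.ne 2)).mp h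

end SAlg

/-! ### Supermodules -/

section SMod

variable [NeZero (2 : K)]

/-- A supermodule from a module with an involution. -/
def SMod.ofInvolution (A : SAlg.{u} K) (M : Type u) [AddCommGroup M] [Module K M] [Module A M]
    [IsScalarTower K A M] (σ : M →ₗ[K] M) (hσ : ∀ x, σ (σ x) = x)
    (hs : ∀ (a : A) (x : M), σ (a • x) = (A.par 1).toAlgHom a • σ x) : SMod A :=
  let gr : ZMod 2 → Submodule K M := fun i => LinearMap.eqLocus σ (SAlg.sg K i • LinearMap.id)
  have mem_gr : ∀ i x, x ∈ gr i ↔ σ x = SAlg.sg K i • x := fun _ _ => Iff.rfl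
  let toComp : ∀ i, M →ₗ[K] gr i := fun i =>
    LinearMap.codRestrict (gr i) ((2 : K)⁻¹ • (LinearMap.id + SAlg.sg K i • σ)) fun a => by
      rw [mem_gr]
      simp only [LinearMap.smul_apply, LinearMap.add_apply, LinearMap.id_apply, map_smul, map_add,
        hσ, smul_add, smul_smul]
      rw [mul_left_comm, SAlg.sg_mul_self, mul_one, add_comm, mul_comm]
  have toComp_apply : ∀ i a, (toComp i a : M) = (2 : K)⁻¹ • (a + SAlg.sg K i • σ a) :=
    fun _ _ => rfl
  have h2 : (2 : K) ≠ 0 := NeZero.ne 2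
  letI : DirectSum.Decomposition gr := DirectSum.Decomposition.ofLinearMap _
    (∑ i, (DirectSum.lof K (ZMod 2) (fun i => gr i) i) ∘ₗ toComp i)
    (by
      ext a
      rw [LinearMap.comp_apply, LinearMap.sum_apply, map_sum]
      simp only [LinearMap.comp_apply, DirectSum.coeLinearMap_lof, LinearMap.id_apply]
      rw [SAlg.sum_zmod_two, toComp_apply, toComp_apply, ← smul_add]
      rw [SAlg.sg_zero, SAlg.sg_one, one_smul, neg_one_smul, add_add_add_comm, add_neg_cancel,
        add_zero, ← two_smul K, smul_smul, inv_mul_cancel₀ h2, one_smul])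
    (by
      ext i x : 2
      have hx : σ (x : M) = SAlg.sg K i • (x : M) := x.2
      have hc : ∀ j, toComp j (x : M) = if h : j = i then h ▸ x else 0 := by
        intro j
        split_ifs with h
        · subst h
          apply Subtype.ext
          rw [toComp_apply, hx, smul_smul, SAlg.sg_mul_self, one_smul, ← two_smul K, smul_smul,
            inv_mul_cancel₀ h2, one_smul]
        · apply Subtype.ext
          rw [toComp_apply, hx, smul_smul, ← SAlg.sg_add]
          have : j + i = 1 := by
            clear hx x; revert h; revert i j; decide
          rw [this, SAlg.sg_one, neg_one_smul, add_neg_cancel, smul_zero]; rfl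
      rw [LinearMap.comp_apply, LinearMap.comp_apply, DirectSum.coeLinearMap_lof,
        LinearMap.sum_apply, LinearMap.comp_apply, LinearMap.id_apply]
      rw [Finset.sum_eq_single i]
      · rw [LinearMap.comp_apply, hc, dif_pos rfl]
      · intro j _ hj
        rw [LinearMap.comp_apply, hc, dif_neg hj, map_zero]
      · intro h
        exact absurd (Finset.mem_univ i) h)
  { carrier := M
    grading := gr
    smul_mem := fun i j a x ha hx => by
      rw [mem_gr] at hx ⊢
      rw [hs, A.par_one_of_mem ha, hx, SAlg.sg_add, smul_assoc, smul_comm a (SAlg.sg K j) x,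
        smul_smul] }

end SMod

/-! ### Balanced tensor products and detection of zero by faithful flatness -/

section Descent

variable {A : SAlg.{u} K} {B : Type u} [Ring B] [Algebra K B] (φ : A →ₐ[K] B)

/-- The class of `b ⊗ m` in `B ⊗_A M`. -/
def BaseChange.tmul (M : SMod A) : B →ₗ[K] M →ₗ[K] BaseChange φ M :=
  (TensorProduct.mk K B M).compr₂ (Submodule.mkQ _)

variable {φ}

theorem BaseChange.tmul_smul {M : SMod A} (b : B) (a : A) (m : M) :
    BaseChange.tmul φ M b (a • m) = BaseChange.tmul φ M (b * φ a) m :=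
  ((Submodule.Quotient.eq (baseChangeRel φ M)).mpr
    (Submodule.subset_span ⟨b, a, m, rfl⟩)).symm

@[elab_as_elim]
theorem BaseChange.induction {M : SMod A} {p : BaseChange φ M → Prop}
    (tmul : ∀ b m, p (BaseChange.tmul φ M b m)) (add : ∀ x y, p x → p y → p (x + y))
    (x : BaseChange φ M) : p x := by
  obtain ⟨x, rfl⟩ := Submodule.mkQ_surjective _ x
  induction x with
  | zero => simpa using tmul 0 0
  | tmul b m => exact tmul b m
  | add x y hx hy => rw [map_add]; exact add _ _ hx hy

theorem baseChangeMap_tmul {M N : SMod A} (f : SMod.Hom M N) (b : B) (m : M) :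
    baseChangeMap φ f (BaseChange.tmul φ M b m) = BaseChange.tmul φ N b (f.toLinearMap m) := rfl

/-- A map from `B ⊗_A M` given by a balanced bilinear map. -/
def BaseChange.lift {M : SMod A} {V : Type*} [AddCommGroup V] [Module K V]
    (L : B →ₗ[K] M →ₗ[K] V) (hL : ∀ b a m, L (b * φ a) m = L b (a • m)) :
    BaseChange φ M →ₗ[K] V :=
  Submodule.liftQ _ (TensorProduct.lift L) (by
    rw [baseChangeRel, Submodule.span_le]
    rintro _ ⟨b, a, m, rfl⟩
    simp [hL])

/-- Left multiplication by `b` descends to B ⊗_A M and carries 1 ⊗ m to b ⊗ m. -/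
theorem BaseChange.tmul_eq_zero_of_one {M : SMod A} {m : M} (h : BaseChange.tmul φ M 1 m = 0)
    (b : B) : BaseChange.tmul φ M b m = 0 := by
  have := congrArg (BaseChange.lift (φ := φ) (M := M)
    ((BaseChange.tmul φ M).comp (LinearMap.mulLeft K b)) (fun b' a m => by
      change BaseChange.tmul φ M (b * (b' * φ a)) m = BaseChange.tmul φ M (b * b') (a • m)
      rw [BaseChange.tmul_smul, mul_assoc])) h
  rw [map_zero] at this
  rw [← this]
  change _ = BaseChange.tmul φ M (b * 1) m
  rw [mul_one]

/-- The zero morphism of supermodules. -/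
def SMod.zeroHom (M N : SMod A) : SMod.Hom M N := ⟨0, fun _ _ _ => zero_mem _⟩

variable [NeZero (2 : K)]

/-- The zero supermodule. -/
def SMod.zero (A : SAlg.{u} K) : SMod A :=
  SMod.ofInvolution A PUnit.{u + 1} LinearMap.id (fun _ => rfl) fun _ _ => rfl

/-- Homogeneous elements of a supermodule are detected by a faithfully flat base change. -/
theorem IsFaithfullyFlat.eq_zero (hφ : IsFaithfullyFlat φ) {N : Type u} [AddCommGroup N]
    [Module K N] [Module A N] [IsScalarTower K A N] (σ : N →ₗ[K] N) (hσ : ∀ x, σ (σ x) = x)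
    (hs : ∀ (a : A) (x : N), σ (a • x) = (A.par 1).toAlgHom a • σ x) {n : N} (i : ZMod 2)
    (hn : σ n = SAlg.sg K i • n)
    (h : BaseChange.tmul φ (SMod.ofInvolution A N σ hσ hs) 1 n = 0) : n = 0 := by
  -- Homogeneity of `n` makes the cyclic submodule A·n stable under the involution, hence a
  -- supermodule.
  have hmem : ∀ x ∈ Submodule.span A {n}, σ x ∈ Submodule.span A {n} := by
    intro x hx
    obtain ⟨a, rfl⟩ := Submodule.mem_span_singleton.mp hx
    rw [hs, hn]
    exact Submodule.smul_mem _ _ (Submodule.smul_of_tower_mem _ _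
      (Submodule.mem_span_singleton_self n))
  let σ' : Submodule.span A {n} →ₗ[K] Submodule.span A {n} :=
    { toFun := fun x => ⟨σ x, hmem x x.2⟩
      map_add' := fun x y => Subtype.ext (map_add σ _ _)
      map_smul' := fun c x => Subtype.ext (map_smul σ _ _) }
  have : IsScalarTower K A (Submodule.span A {n}) :=
    ⟨fun c a x => Subtype.ext (smul_assoc c a x.1)⟩
  let C : SMod A := SMod.ofInvolution A (Submodule.span A {n}) σ'
    (fun x => Subtype.ext (hσ x)) (fun a x => Subtype.ext (hs a x))
  let N' : SMod A := SMod.ofInvolution A N σ hσ hs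
  let ι : SMod.Hom C N' :=
    SMod.Hom.mk (M := C) (N := N') (Submodule.span A {n}).subtype (fun j x hx => by
      exact congrArg Subtype.val hx)
  let n' : C := (⟨n, Submodule.mem_span_singleton_self n⟩ : Submodule.span A {n})
  -- Flatness: 0 → A·n → N is exact, so 1 ⊗ n already vanishes in B ⊗ A·n.
  have hexact : Function.Exact (SMod.zeroHom (SMod.zero A) C).toLinearMap ι.toLinearMap := by
    intro x
    constructor
    · intro hx
      refine ⟨0, ?_⟩
      rw [map_zero]
      exact (Subtype.ext hx : x = (0 : Submodule.span A {n})).symm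
    · rintro ⟨y, rfl⟩
      exact map_zero ι.toLinearMap
  have h1 : BaseChange.tmul φ C 1 n' = 0 := by
    obtain ⟨y, hy⟩ := (((hφ _ _ _ _ _).mp hexact) (BaseChange.tmul φ C 1 n')).mp
      (by rw [baseChangeMap_tmul]; exact h)
    rw [← hy]
    clear hy
    induction y using BaseChange.induction with
    | tmul b m => rw [baseChangeMap_tmul]; exact map_zero _
    | add x y hx hy => rw [map_add, hx, hy, add_zero]
  have h2 : ∀ z : BaseChange φ C, z = 0 := by
    intro z
    induction z using BaseChange.induction with
    | tmul b m =>
      obtain ⟨a, ha⟩ := Submodule.mem_span_singleton.mp (show m.1 ∈ Submodule.span A {n} from m.2)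
      have : m = a • n' := Subtype.ext ha.symm
      rw [this, BaseChange.tmul_smul]
      exact BaseChange.tmul_eq_zero_of_one h1 _
    | add x y hx hy => rw [hx, hy, add_zero]
  -- Faithfulness: B ⊗ A·n = 0, so 0 → A·n → 0 is exact after base change and hence before it.
  have h3 : Function.Exact (baseChangeMap φ (SMod.zeroHom (SMod.zero A) C))
      (baseChangeMap φ (SMod.zeroHom C (SMod.zero A))) := fun z =>
    ⟨fun _ => ⟨0, by rw [map_zero, h2 z]⟩, fun _ => by rw [h2 z, map_zero]⟩
  obtain ⟨y, hy⟩ := ((hφ _ _ _ _ _).mpr h3 n').mp rfl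
  exact (congrArg Subtype.val hy).symm

end Descent

namespace SAlg

/-! ### The amalgamated product S ⊗_R T -/

section Amalgam

variable [NeZero (2 : K)] {R S T : SAlg.{u} K} (φ : R ⟶ S) (ψ : R ⟶ T)

/-- The relations that define `S ⊗_R T` as a quotient of `S ⊗_K T`. -/
def amalgamRel : Submodule K (tensor S T) :=
  Submodule.span K {x | ∃ (s : S) (r : R) (t : T),
    x = tmul S T (s * φ.toAlgHom r) t - tmul S T s (ψ.toAlgHom r * t)}

/-- Moving a homogeneous `t` past `s'` and past `r` applies the same power of parity to both, so a
multiple of a relation is again a relation. The K-span of the relations is thus already an ideal,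
and the superalgebra S ⊗_R T has the balanced tensor product as underlying space. -/
theorem tmul_mul_mem_amalgamRel (s s' : S) (r : R) (t t' : T) :
    tmul S T s t * (tmul S T (s' * φ.toAlgHom r) t' - tmul S T s' (ψ.toAlgHom r * t')) ∈
      amalgamRel φ ψ := by
  induction t using T.homogeneous_induction with
  | hom j t ht =>
    rw [mul_sub, tmul_mul_tmul _ _ _ ht, tmul_mul_tmul _ _ _ ht, map_mul (S.par j).toAlgHom, ← hom_par, ← mul_assoc,
      ← mul_assoc t, T.mul_eq_par_mul ht (ψ.toAlgHom r), ← hom_par, mul_assoc _ t]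
    exact Submodule.subset_span ⟨_, _, _, rfl⟩
  | add t u ht hu =>
    rw [map_add, add_mul]
    exact add_mem ht hu

/-- The ideal of `S ⊗_K T` that defines `S ⊗_R T`. -/
def amalgamIdeal : Ideal (tensor S T) where
  __ := (amalgamRel φ ψ).toAddSubmonoid
  smul_mem' c x hx := by
    change c * x ∈ amalgamRel φ ψ
    induction c using tensor_induction with
    | tmul s t =>
      have hx' : x ∈ Submodule.span K _ := hx
      clear hx
      induction hx' using Submodule.span_induction with
      | mem x h =>
        obtain ⟨s', r, t', rfl⟩ := h
        exact tmul_mul_mem_amalgamRel φ ψ s s' r t t'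
      | zero => rw [mul_zero]; exact zero_mem _
      | add x y hx hy h1 h2 => rw [mul_add]; exact add_mem h1 h2
      | smul c x hx h => rw [mul_smul_comm]; exact Submodule.smul_mem _ _ h
    | add c d hc hd => rw [add_mul]; exact add_mem hc hd

theorem mem_amalgamIdeal (x : tensor S T) : x ∈ amalgamIdeal φ ψ ↔ x ∈ amalgamRel φ ψ := Iff.rfl

/-- The component of degree i is half of `a` plus or minus its image under parity. -/
theorem homogeneous_of_par (A : SAlg.{u} K) (I : Ideal A)
    (h : ∀ a ∈ I, (A.par 1).toAlgHom a ∈ I) (a : A) (ha : a ∈ I) (i : ZMod 2) :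
    A.component i a ∈ I := by
  have h2 : (2 : K) ≠ 0 := NeZero.ne 2
  have key : A.component i a = (2 : K)⁻¹ • (a + sg K i • (A.par 1).toAlgHom a) := by
    rw [eq_inv_smul_iff₀ h2]
    conv_rhs => rw [← A.component_zero_add_one a]
    rw [map_add, A.par_one_of_mem (A.component_mem 0 a), A.par_one_of_mem (A.component_mem 1 a)]
    rcases zmod_two_cases i with rfl | rfl <;> simp only [sg_zero, sg_one, one_smul, neg_smul,
      two_smul] <;> abel
  rw [key]
  exact Submodule.smul_of_tower_mem I _ (I.add_mem ha (Submodule.smul_of_tower_mem I _ (h a ha)))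

theorem amalgamIdeal_homogeneous : ∀ x ∈ amalgamIdeal φ ψ, ∀ i,
    (tensor S T).component i x ∈ amalgamIdeal φ ψ := by
  refine homogeneous_of_par _ _ fun x hx => ?_
  rw [mem_amalgamIdeal] at hx ⊢
  have hx' : x ∈ Submodule.span K _ := hx
  clear hx
  induction hx' using Submodule.span_induction with
  | mem x h =>
    obtain ⟨s, r, t, rfl⟩ := h
    rw [map_sub, par_tmul, par_tmul, map_mul (S.par 1).toAlgHom, map_mul (T.par 1).toAlgHom, ← hom_par, ← hom_par]
    exact Submodule.subset_span ⟨_, _, _, rfl⟩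
  | zero => rw [map_zero]; exact zero_mem _
  | add x y hx hy h1 h2 => rw [map_add]; exact add_mem h1 h2
  | smul c x hx h => rw [map_smul]; exact Submodule.smul_mem _ _ h

/-- If `s` and `t` have the same image in every superalgebra under `S` and `T` over `R`, then
`s ⊗ 1 = 1 ⊗ t` in `S ⊗_R T`. -/
theorem eq_of_forall_eq_over {s : S} {t : T}
    (h : ∀ (P : SAlg.{u} K) (a : S ⟶ P) (b : T ⟶ P), φ ≫ a = ψ ≫ b →
      a.toAlgHom s = b.toAlgHom t)
    {V : Type*} [AddCommGroup V] [Module K V] (L : S →ₗ[K] T →ₗ[K] V)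
    (hL : ∀ s r t, L (s * φ.toAlgHom r) t = L s (ψ.toAlgHom r * t)) : L s 1 = L 1 t := by
  -- The hypothesis is needed only for the universal pair S → S ⊗_R T ← T. Membership in the span of
  -- the relations then transfers the equality to every balanced bilinear map.
  let q := quotientMk (tensor S T) (amalgamIdeal φ ψ) (amalgamIdeal_homogeneous φ ψ)
  have h1 : q.toAlgHom ((inl S T).toAlgHom s) = q.toAlgHom ((inr S T).toAlgHom t) := by
    refine h _ (inl S T ≫ q) (inr S T ≫ q) (hom_ext fun r => ?_)
    rw [← sub_eq_zero]
    refine (map_sub q.toAlgHom _ _).symm.trans ((quotientMk_eq_zero_iff _ _ _ _).mpr ?_)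
    refine (mem_amalgamIdeal φ ψ _).mpr (Submodule.subset_span ⟨1, r, 1, ?_⟩)
    rw [one_mul, mul_one]; rfl
  rw [← sub_eq_zero, ← map_sub] at h1
  have h2 := (mem_amalgamIdeal φ ψ _).mp ((quotientMk_eq_zero_iff _ _ _ _).mp h1)
  let L' : tensor S T →ₗ[K] V := (TensorProduct.lift L :)
  have hL' : ∀ s t, L' (tmul S T s t) = L s t := fun s t => TensorProduct.lift.tmul s t
  have h3 : amalgamRel φ ψ ≤ LinearMap.ker L' := by
    rw [amalgamRel, Submodule.span_le]
    rintro _ ⟨s, r, t, rfl⟩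
    change L' _ = 0
    rw [map_sub, hL', hL', hL, sub_self]
  have h4 : L' _ = 0 := h3 h2
  rwa [inl_apply, inr_apply, map_sub, hL', hL', sub_eq_zero] at h4

end Amalgam

theorem bilinear_pi_apply {n : ℕ} {V : Fin n → Type u} {M : Type*} [∀ k, AddCommGroup (V k)]
    [∀ k, Module K (V k)] [AddCommGroup M] [Module K M]
    (L : (∀ k, V k) →ₗ[K] (∀ k, V k) →ₗ[K] M) (x y : ∀ k, V k) :
    L x y = ∑ k, ∑ l, L (LinearMap.single K V k (x k)) (LinearMap.single K V l (y l)) := by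
  have h : ∀ x : ∀ k, V k, x = ∑ k, LinearMap.single K V k (x k) :=
    fun x => (Finset.univ_sum_single x).symm
  conv_lhs => rw [h x, h y]
  simp only [map_sum, LinearMap.sum_apply]
  exact Finset.sum_comm

/-! ### Faithfully flat descent for affine superschemes -/

section Sheaf

variable [NeZero (2 : K)] {R : SAlg.{u} K} {n : ℕ} {S : Fin n → SAlg.{u} K} {ι : ∀ i, R ⟶ S i}

/-- For each homogeneous component of `r`, 1 ⊗ r = φ(r) ⊗ 1 = 0 in B ⊗_R R, where B is the product
of the covering. -/
theorem eq_zero_of_ffCovering (hι : ffCoverings R n S ι) {r : R}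
    (hr : ∀ k, (ι k).toAlgHom r = 0) : r = 0 := by
  let M : SMod R := SMod.ofInvolution R R (R.par 1).toAlgHom.toLinearMap (R.par_self 1)
    fun a x => map_mul (R.par 1).toAlgHom a x
  have key : ∀ i, R.component i r = 0 := fun i => by
    refine IsFaithfullyFlat.eq_zero hι (R.par 1).toAlgHom.toLinearMap (R.par_self 1)
      (fun a x => map_mul (R.par 1).toAlgHom a x) i (R.par_one_of_mem (R.component_mem i r)) ?_
    have h := BaseChange.tmul_smul (φ := AlgHom.pi fun k => (ι k).toAlgHom) (M := M) 1
      (R.component i r) (1 : R)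
    have h0 : (AlgHom.pi fun k => (ι k).toAlgHom) (R.component i r) = 0 := funext fun k => by
      change (ι k).toAlgHom (R.component i r) = 0
      rw [hom_component, hr k]
      exact map_zero ((S k).proj i)
    rw [h0, mul_zero, map_zero] at h
    exact (congrArg (BaseChange.tmul _ M 1) (mul_one (R.component i r)).symm).trans h
  rw [← R.component_zero_add_one r, key, key, add_zero]

/-- Put B = ∏ S_k and N = B/R·1. The compatibility gives s ⊗ 1 = 1 ⊗ s on each pair of factors, so
in B ⊗_R N the class of 1 ⊗ s equals that of s ⊗ 1, which is 0. Faithful flatness gives s = 0 in N,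
that is, s ∈ R·1. -/
theorem exists_of_ffCovering (hι : ffCoverings R n S ι) (i : ZMod 2) (s : ∀ i, S i)
    (hs : ∀ k, s k ∈ (S k).grading i)
    (h : ∀ (k l : Fin n) (T : SAlg.{u} K) (a : S k ⟶ T) (b : S l ⟶ T),
      ι k ≫ a = ι l ≫ b → a.toAlgHom (s k) = b.toAlgHom (s l)) :
    ∃ r : R, ∀ k, (ι k).toAlgHom r = s k := by
  let : ∀ k, Module R (S k) := fun k => Module.compHom (S k) (ι k).toAlgHom.toRingHom
  have smul_def : ∀ k (r : R) (x : S k), r • x = (ι k).toAlgHom r * x := fun _ _ _ => rfl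
  have : ∀ k, IsScalarTower K R (S k) := fun k => ⟨fun c r x => by
    rw [smul_def, smul_def, map_smul, smul_mul_assoc]⟩
  let B : Type u := ∀ k, S k
  let σ : B →ₗ[K] B := LinearMap.pi fun k => ((S k).par 1).toAlgHom.toLinearMap ∘ₗ
    LinearMap.proj k
  have hσs : ∀ (r : R) (x : B), σ (r • x) = (R.par 1).toAlgHom r • σ x := fun r x =>
    funext fun k => by
      change ((S k).par 1).toAlgHom ((ι k).toAlgHom r * x k) =
        (ι k).toAlgHom ((R.par 1).toAlgHom r) * ((S k).par 1).toAlgHom (x k)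
      rw [map_mul, hom_par]
  let M : SMod R := SMod.ofInvolution R B σ (fun x => funext fun k => (S k).par_self 1 (x k)) hσs
  let W : Submodule R B := Submodule.span R {1}
  let e := Submodule.Quotient.restrictScalarsEquiv K W
  have hW : W.restrictScalars K ≤ (W.restrictScalars K).comap σ := by
    intro x hx
    obtain ⟨r, rfl⟩ := Submodule.mem_span_singleton.mp hx
    refine Submodule.mem_span_singleton.mpr ⟨(R.par 1).toAlgHom r, ?_⟩
    rw [hσs]
    exact congrArg _ (funext fun k => (map_one ((S k).par 1).toAlgHom).symm)
  let τ : (B ⧸ W) →ₗ[K] (B ⧸ W) :=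
    e.toLinearMap ∘ₗ Submodule.mapQ _ _ σ hW ∘ₗ e.symm.toLinearMap
  have hτ : ∀ x : B, τ (W.mkQ x) = W.mkQ (σ x) := fun _ => rfl
  have hττ : ∀ x, τ (τ x) = x := fun x => by
    obtain ⟨x, rfl⟩ := W.mkQ_surjective x
    rw [hτ, hτ]
    exact congrArg _ (funext fun k => (S k).par_self 1 (x k))
  have hτs : ∀ (r : R) x, τ (r • x) = (R.par 1).toAlgHom r • τ x := fun r x => by
    obtain ⟨x, rfl⟩ := W.mkQ_surjective x
    rw [← map_smul, hτ, hτ, hσs, map_smul]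
  let N : SMod R := SMod.ofInvolution R (B ⧸ W) τ hττ hτs
  let φ : R →ₐ[K] (∀ k, S k) := AlgHom.pi fun k => (ι k).toAlgHom
  have hzero : W.mkQ (s : B) = 0 := by
    refine IsFaithfullyFlat.eq_zero hι τ hττ hτs i ?_ ?_
    · rw [hτ]
      exact congrArg W.mkQ (funext fun k => (S k).par_one_of_mem (hs k) : σ s = sg K i • s)
    · let L : ∀ k l, S k →ₗ[K] S l →ₗ[K] BaseChange φ N := fun k l =>
        (BaseChange.tmul φ N).compl₁₂ (LinearMap.single K (fun k => (S k : Type u)) k)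
          ((W.mkQ.restrictScalars K : B →ₗ[K] N) ∘ₗ LinearMap.single K (fun k => (S k : Type u)) l)
      have hL : ∀ k l, L k l (s k) 1 = L k l 1 (s l) := fun k l => by
        refine eq_of_forall_eq_over (ι k) (ι l) (h k l) (L k l) fun x r y => ?_
        have h1 : LinearMap.single K (fun k => (S k : Type u)) k (x * (ι k).toAlgHom r) =
            LinearMap.single K (fun k => (S k : Type u)) k x * φ r := funext fun j => by
          by_cases hj : j = k
          · subst hj; simp [φ]
          · simp [hj]
        have h2 : LinearMap.single K (fun k => (S k : Type u)) l ((ι l).toAlgHom r * y) =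
            r • LinearMap.single K (fun k => (S k : Type u)) l y := funext fun j => by
          by_cases hj : j = l
          · subst hj; simp [smul_def]
          · simp [hj]
        change BaseChange.tmul φ N _ (W.mkQ _) = BaseChange.tmul φ N _ (W.mkQ _)
        rw [h1, h2, map_smul]
        exact (BaseChange.tmul_smul (φ := φ) (M := N) _ r _).symm
      have hsum : ∀ x y : B, BaseChange.tmul φ N x (W.mkQ y) = ∑ k, ∑ l, L k l (x k) (y l) :=
        fun x y => bilinear_pi_apply ((BaseChange.tmul φ N).compl₂
          (W.mkQ.restrictScalars K : B →ₗ[K] N)) x y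
      refine (hsum 1 s).trans ?_
      refine (Finset.sum_congr rfl fun k _ => Finset.sum_congr rfl fun l _ =>
        (hL k l).symm).trans ?_
      refine (hsum s 1).symm.trans ?_
      rw [(Submodule.Quotient.mk_eq_zero W).mpr (Submodule.mem_span_singleton_self 1) |>
        (show W.mkQ 1 = 0 from ·)]
      exact map_zero _
  have hmem : (s : B) ∈ W := (Submodule.Quotient.mk_eq_zero W).mp hzero
  obtain ⟨r, hr⟩ := Submodule.mem_span_singleton.mp hmem
  refine ⟨r, fun k => ?_⟩
  rw [← hr]
  exact (mul_one ((ι k).toAlgHom r)).symm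

/-- Affine superschemes are dur sheaves. -/
theorem isSheafFor_SSp (X : SAlg.{u} K) : IsSheafFor ffCoverings X.SSp := by
  intro R n S ι hι x hx
  have hx' : ∀ (k l : Fin n) (T : SAlg.{u} K) (a : S k ⟶ T) (b : S l ⟶ T), ι k ≫ a = ι l ≫ b →
      ∀ c : X, a.toAlgHom ((x k : X ⟶ S k).toAlgHom c) =
        b.toAlgHom ((x l : X ⟶ S l).toAlgHom c) := fun k l T a b hab c =>
    congrArg (fun f : X ⟶ T => f.toAlgHom c) (hx k l T a b hab)
  have hex : ∀ c : X, ∃ r : R, ∀ k, (ι k).toAlgHom r = (x k : X ⟶ S k).toAlgHom c := fun c => by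
    have hi := fun i => exists_of_ffCovering hι i
      (fun k => (x k : X ⟶ S k).toAlgHom (X.component i c))
      (fun k => (x k : X ⟶ S k).map_mem i _ (X.component_mem i c))
      (fun k l T a b hab => hx' k l T a b hab _)
    obtain ⟨r₀, h₀⟩ := hi 0
    obtain ⟨r₁, h₁⟩ := hi 1
    refine ⟨r₀ + r₁, fun k => ?_⟩
    rw [map_add, h₀, h₁, ← map_add, X.component_zero_add_one]
  have huniq : ∀ r r' : R, (∀ k, (ι k).toAlgHom r = (ι k).toAlgHom r') → r = r' :=
    fun r r' h => sub_eq_zero.mp (eq_zero_of_ffCovering hι fun k => by rw [map_sub, h, sub_self])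
  choose f hf using hex
  let y : X →ₐ[K] R :=
    { toFun := f
      map_one' := huniq _ _ fun k => by rw [hf, map_one, map_one]
      map_mul' := fun a b => huniq _ _ fun k => by rw [map_mul, hf, hf, hf, map_mul]
      map_zero' := huniq _ _ fun k => by rw [hf, map_zero, map_zero]
      map_add' := fun a b => huniq _ _ fun k => by rw [map_add, hf, hf, hf, map_add]
      commutes' := fun c => huniq _ _ fun k => by rw [hf, AlgHom.commutes, AlgHom.commutes] }
  have hy : ∀ k c, (ι k).toAlgHom (y c) = (x k : X ⟶ S k).toAlgHom c := fun k c => hf c k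
  refine ⟨homOfPar y fun a => huniq _ _ fun k => by rw [hy, hom_par, hom_par, hy],
    fun k => hom_ext fun c => hy k c, fun z hz => hom_ext fun c => huniq _ _ fun k => ?_⟩
  exact (congrArg (fun f : X ⟶ S k => f.toAlgHom c) (hz k)).trans (hy k c).symm

end Sheaf

end SAlg

/-! ### Quotient sheaves -/

namespace AffineSupergroup.ClosedSubgroup

variable {G : AffineSupergroup.{u} K} (H : G.ClosedSubgroup)

/-- If `K[G]^H → K[G]` is a covering and the fibres of `G(T) → Hom(K[G]^H, T)` are the orbits of
`H(T)`, then the canonical morphism makes `SSp K[G]^H` the associated sheaf. -/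
theorem isAssociatedSheaf_quotientMap {Cov : Coverings.{u} K}
    (hsheaf : IsSheafFor Cov H.invariants.SSp)
    (hcov : Cov H.invariants 1 (fun _ => G.coord) fun _ => H.invariantsIncl)
    (horb : ∀ (T : SAlg.{u} K) (g g' : G.coord ⟶ T),
      H.invariantsIncl ≫ g = H.invariantsIncl ≫ g' → g⁻¹ * g' ∈ H.points T) :
    IsAssociatedSheaf.{w, u} Cov H.quotientMap where
  isSheaf := hsheaf
  bijective Z hZ := by
    -- Yoneda: a transformation is determined by its value at the identity point, or, for the naive
    -- quotient, at the coset of the identity point of G.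
    have hval : ∀ (v : H.invariants.SSp ⋙ uliftFunctor.{w, u} ⟶ Z) (B : SAlg.{u} K)
        (f : H.invariants ⟶ B), v.app B ⟨f⟩ = Z.map f (v.app H.invariants ⟨𝟙 _⟩) := by
      intro v B f
      refine Eq.trans ?_ (NatTrans.naturality_apply v f ⟨𝟙 _⟩)
      exact congrArg (fun g => v.app B ⟨g⟩) (Category.id_comp f).symm
    have hval' : ∀ (v : H.naiveQuotient ⋙ uliftFunctor.{w, u} ⟶ Z) (B : SAlg.{u} K)
        (f : G.coord ⟶ B), v.app B ⟨QuotientGroup.mk f⟩ =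
          Z.map f (v.app G.coord ⟨QuotientGroup.mk (𝟙 _)⟩) := by
      intro v B f
      refine Eq.trans ?_ (NatTrans.naturality_apply v f ⟨QuotientGroup.mk (𝟙 _)⟩)
      exact congrArg (fun g : G.coord ⟶ B => v.app B ⟨QuotientGroup.mk g⟩)
        (Category.id_comp f).symm
    have hinj : ∀ z z' : Z.obj H.invariants,
        Z.map H.invariantsIncl z = Z.map H.invariantsIncl z' → z = z' := by
      intro z z' h
      refine (hZ _ _ _ _ hcov (fun _ => Z.map H.invariantsIncl z') ?_).unique
        (fun _ => h) (fun _ => rfl)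
      intro i j T a b hab
      rw [← Functor.map_comp_apply, ← Functor.map_comp_apply, hab]
    constructor
    · intro v v' h
      have hz : v.app H.invariants ⟨𝟙 _⟩ = v'.app H.invariants ⟨𝟙 _⟩ := by
        refine hinj _ _ ?_
        rw [← hval, ← hval]
        exact ConcreteCategory.congr_hom (NatTrans.congr_app h G.coord)
          ⟨QuotientGroup.mk (𝟙 G.coord)⟩
      ext B ⟨f⟩
      exact (hval v B f).trans ((congrArg (Z.map f) hz).trans (hval v' B f).symm)
    · intro v
      -- The value at the generic coset is a descent datum for K[G]^H → K[G]: by `horb`, two maps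
      -- K[G] → T that agree on K[G]^H define the same coset. The glued element `y` represents the
      -- factorization.
      obtain ⟨y, hy, -⟩ := hZ _ _ _ _ hcov (fun _ => v.app G.coord ⟨QuotientGroup.mk (𝟙 _)⟩)
        (by
          intro i j T a b hab
          rw [← hval', ← hval']
          exact congrArg (fun g => v.app T ⟨g⟩) (QuotientGroup.eq.mpr (horb T a b hab)))
      refine ⟨{ app := fun B => TypeCat.ofHom fun f => Z.map f.down y
                naturality := ?_ }, ?_⟩
      · intro B C f
        ext ⟨g⟩
        exact Functor.map_comp_apply Z g f y
      · ext B ⟨x⟩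
        induction x using QuotientGroup.induction_on with
        | H g =>
          refine Eq.trans ?_ ((congrArg (Z.map g) (hy 0)).trans (hval' v B g).symm)
          exact Functor.map_comp_apply Z H.invariantsIncl g y

end AffineSupergroup.ClosedSubgroup

namespace SAlg

/-! ### Homogeneous bases -/

section HomogeneousBasis

variable {ι : Type} {C : SAlg.{u} K} (e : Module.Basis ι K C) (p : ι → ZMod 2)

theorem coord_par (he : ∀ i, e i ∈ C.grading (p i)) (d : ZMod 2) (i : ι) (c : C) :
    e.coord i ((C.par d).toAlgHom c) = sg K (d * p i) * e.coord i c := by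
  have : e.coord i ∘ₗ (C.par d).toAlgHom.toLinearMap = sg K (d * p i) • e.coord i := by
    refine e.ext fun k => ?_
    rw [LinearMap.comp_apply, AlgHom.toLinearMap_apply, C.par_of_mem d (he k), map_smul,
      LinearMap.smul_apply, e.coord_apply, e.repr_self]
    by_cases h : k = i
    · rw [h]
    · rw [Finsupp.single_eq_of_ne (Ne.symm h), smul_zero, smul_zero]
  exact LinearMap.congr_fun this c

variable (C) in
theorem exists_homogeneousBasis [FiniteDimensional K C] :
    ∃ (ι : Type) (_ : Fintype ι) (e : Module.Basis ι K C) (p : ι → ZMod 2),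
      ∀ i, e i ∈ C.grading (p i) := by
  classical
  let h := DirectSum.Decomposition.isInternal C.grading
  let b := fun i => Module.finBasis K (C.grading i)
  refine ⟨_, inferInstance, h.collectedBasis b, fun i => i.1, fun i => ?_⟩
  exact h.collectedBasis_mem b i

end HomogeneousBasis

variable [NeZero (2 : K)]

theorem coord_eq_zero {ι : Type} {C : SAlg.{u} K} (e : Module.Basis ι K C) (p : ι → ZMod 2)
    (he : ∀ i, e i ∈ C.grading (p i)) {j : ZMod 2} {c : C}
    (hc : c ∈ C.grading j) {i : ι} (h : p i ≠ j) : e.coord i c = 0 := by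
  have h2 : (2 : K) ≠ 0 := NeZero.ne 2
  have h1 := coord_par e p he 1 i c
  rw [C.par_one_of_mem hc, map_smul, one_mul, smul_eq_mul, ← sub_eq_zero, ← sub_mul,
    mul_eq_zero] at h1
  refine h1.resolve_left fun h3 => ?_
  have : ∀ a b : ZMod 2, a ≠ b → (a = 0 ∧ b = 1) ∨ (a = 1 ∧ b = 0) := by decide
  rcases this _ _ h with ⟨h4, h5⟩ | ⟨h4, h5⟩ <;> rw [h4, h5, sg_zero, sg_one] at h3 <;>
    refine h2 ?_
  · linear_combination -h3
  · linear_combination h3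

/-! ### Contractions -/

section Contract

variable {S T C : SAlg.{u} K}

/-- The map `id ⊗ f : T ⊗ C → T` for a linear functional `f` on `C`. -/
def contract (T : SAlg.{u} K) (f : C →ₗ[K] K) : tensor T C →ₗ[K] T :=
  (TensorProduct.lift ((LinearMap.lsmul K T).comp f).flip :
    TensorProduct K T C →ₗ[K] T)

theorem contract_tmul (f : C →ₗ[K] K) (t : T) (c : C) :
    contract T f (tmul T C t c) = f c • t := rfl

theorem contract_inl_mul (f : C →ₗ[K] K) (t : T) (z : tensor T C) :
    contract T f ((inl T C).toAlgHom t * z) = t * contract T f z := by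
  induction z using tensor_induction with
  | tmul s c => rw [inl_mul_tmul, contract_tmul, contract_tmul, mul_smul_comm]
  | add x y hx hy => rw [mul_add, map_add, map_add, hx, hy, mul_add]

/-- The morphism `u ⊗ id`. -/
def mapLeft (C : SAlg.{u} K) (u : S ⟶ T) : tensor S C ⟶ tensor T C := desc (u ≫ inl T C) (inr T C)

theorem inl_mapLeft (u : S ⟶ T) : inl S C ≫ mapLeft C u = u ≫ inl T C := inl_desc _ _

theorem inr_mapLeft (u : S ⟶ T) : inr S C ≫ mapLeft C u = inr T C := inr_desc _ _

theorem mapLeft_tmul (u : S ⟶ T) (s : S) (c : C) :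
    (mapLeft C u).toAlgHom (tmul S C s c) = tmul T C (u.toAlgHom s) c := inl_mul_inr _ _

theorem contract_mapLeft (f : C →ₗ[K] K) (u : S ⟶ T) (z : tensor S C) :
    contract T f ((mapLeft C u).toAlgHom z) = u.toAlgHom (contract S f z) := by
  induction z using tensor_induction with
  | tmul s c => rw [mapLeft_tmul, contract_tmul, contract_tmul, map_smul]
  | add x y hx hy => rw [map_add, map_add, map_add, map_add, hx, hy]

variable {ι : Type} (e : Module.Basis ι K C) (p : ι → ZMod 2) (he : ∀ i, e i ∈ C.grading (p i))

include he in
-- The functional e^i sees only elements of parity `p i`, and moving `t` to the left past such an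
-- element applies parity `p i` times.
theorem contract_coord_mul_inl (i : ι) (z : tensor T C) (t : T) :
    contract T (e.coord i) (z * (inl T C).toAlgHom t) =
      contract T (e.coord i) z * (T.par (p i)).toAlgHom t := by
  induction z using tensor_induction with
  | tmul s c =>
    induction c using C.homogeneous_induction with
    | hom j c hc =>
      rw [inl_apply, tmul_mul_tmul _ _ _ hc, mul_one, contract_tmul, contract_tmul, smul_mul_assoc]
      by_cases h : p i = j
      · rw [h]
      · rw [coord_eq_zero e p he hc h, zero_smul, zero_smul]
    | add x y hx hy => simp only [map_add, add_mul, hx, hy]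
  | add x y hx hy => simp only [map_add, add_mul, hx, hy]

include he in
theorem contract_coord_mem (i : ι) {d : ZMod 2} {z : tensor T C} (hz : z ∈ (tensor T C).grading d) :
    contract T (e.coord i) z ∈ T.grading (d + p i) := by
  have key : ∀ z : tensor T C, contract T (e.coord i) (((tensor T C).par 1).toAlgHom z) =
      sg K (p i) • (T.par 1).toAlgHom (contract T (e.coord i) z) := by
    intro z
    induction z using tensor_induction with
    | tmul s c =>
      rw [par_tmul, contract_tmul, contract_tmul, coord_par e p he, one_mul, map_smul, smul_smul]
    | add x y hx hy => simp only [map_add, smul_add, hx, hy]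
  rw [mem_grading_iff] at hz ⊢
  have h := key z
  rw [hz, map_smul] at h
  rw [sg_add, mul_comm, mul_smul, h, smul_smul, sg_mul_self, one_smul]

variable [Fintype ι]

theorem sum_contract_mul {R : SAlg.{u} K} (f : T ⟶ R) (g : C ⟶ R) (z : tensor T C) :
    ∑ i, f.toAlgHom (contract T (e.coord i) z) * g.toAlgHom (e i) = (desc f g).toAlgHom z := by
  induction z using tensor_induction with
  | tmul s c =>
    rw [desc_tmul]
    conv_rhs => rw [← e.sum_repr c]
    rw [map_sum, Finset.mul_sum]
    refine Finset.sum_congr rfl fun i _ => ?_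
    rw [contract_tmul, map_smul, map_smul, smul_mul_assoc, mul_smul_comm]
    rfl
  | add x y hx hy => simp only [map_add, add_mul, Finset.sum_add_distrib, hx, hy]

theorem desc_inl_inr : desc (inl T C) (inr T C) = 𝟙 _ :=
  tensor_hom_ext (by rw [inl_desc, Category.comp_id]) (by rw [inr_desc, Category.comp_id])

theorem sum_inl_contract_mul_inr (z : tensor T C) :
    ∑ i, (inl T C).toAlgHom (contract T (e.coord i) z) * (inr T C).toAlgHom (e i) = z := by
  rw [sum_contract_mul e, desc_inl_inr, hom_id_apply]

include he in
/-- The cyclicity of the supertrace of `T`-linear endomorphisms of `T ⊗ C`. -/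
theorem supertrace_comm (X : tensor T C ⟶ tensor T C) (hX : inl T C ≫ X = inl T C)
    (Y : tensor T C →ₗ[K] tensor T C)
    (hY : ∀ t z, Y ((inl T C).toAlgHom t * z) = (inl T C).toAlgHom t * Y z) (r : ZMod 2)
    (hYr : ∀ d, ∀ z ∈ (tensor T C).grading d, Y z ∈ (tensor T C).grading (d + r)) :
    ∑ i, sg K (p i * (1 + r)) •
        contract T (e.coord i) (X.toAlgHom (Y ((inr T C).toAlgHom (e i)))) =
      ∑ i, sg K (p i * (1 + r)) •
        contract T (e.coord i) (Y (X.toAlgHom ((inr T C).toAlgHom (e i)))) := by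
  have hX' : ∀ t z, X.toAlgHom ((inl T C).toAlgHom t * z) =
      (inl T C).toAlgHom t * X.toAlgHom z := fun t z => by
    rw [map_mul, ← hom_comp_apply, hX]
  -- Both supertraces are expanded in matrix entries over T; they contain the same products of
  -- entries in opposite order.
  have h1 : ∀ i, contract T (e.coord i) (X.toAlgHom (Y ((inr T C).toAlgHom (e i)))) =
      ∑ l, contract T (e.coord l) (Y ((inr T C).toAlgHom (e i))) *
        contract T (e.coord i) (X.toAlgHom ((inr T C).toAlgHom (e l))) := fun i => by
    conv_lhs => rw [← sum_inl_contract_mul_inr e (Y ((inr T C).toAlgHom (e i)))]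
    simp only [map_sum, hX', contract_inl_mul]
  have h2 : ∀ i, contract T (e.coord i) (Y (X.toAlgHom ((inr T C).toAlgHom (e i)))) =
      ∑ l, contract T (e.coord l) (X.toAlgHom ((inr T C).toAlgHom (e i))) *
        contract T (e.coord i) (Y ((inr T C).toAlgHom (e l))) := fun i => by
    conv_lhs => rw [← sum_inl_contract_mul_inr e (X.toAlgHom ((inr T C).toAlgHom (e i)))]
    simp only [map_sum, hY, contract_inl_mul]
  simp only [h1, h2, Finset.smul_sum]
  rw [Finset.sum_comm]
  refine Finset.sum_congr rfl fun l _ => Finset.sum_congr rfl fun i _ => ?_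
  have hi := (inr T C).map_mem _ _ (he i)
  have hl := (inr T C).map_mem _ _ (he l)
  -- The entries of Y and X have degrees p i + p l + r and p l + p i. The sign from swapping them
  -- turns the weight of `i` into the weight of `l`.
  rw [supercomm_smul T (contract_coord_mem e p he l (hYr _ _ hi))
    (contract_coord_mem e p he i (X.map_mem _ _ hl)), smul_smul]
  congr 1
  generalize p i = a
  generalize p l = b
  rw [← sg_add]
  congr 1
  clear hYr h1 h2 hi hl
  revert a b r
  decide

end Contract

end SAlg

/-! ### Functions on H over a base T and their translations -/

namespace AffineSupergroup

open SAlg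

variable {G : AffineSupergroup.{u} K}

theorem inv_comp {B C : SAlg.{u} K} (g : G.coord ⟶ B) (f : B ⟶ C) : g⁻¹ ≫ f = (g ≫ f)⁻¹ :=
  map_inv (G.mapHom f) g

theorem one_comp {B C : SAlg.{u} K} (f : B ⟶ C) : (1 : G.coord ⟶ B) ≫ f = 1 :=
  map_one (G.mapHom f)

namespace ClosedSubgroup

variable [NeZero (2 : K)] (H : G.ClosedSubgroup)

/-- The coordinate superalgebra `K[H]`. -/
def coordRing : SAlg.{u} K := G.coord.quotient H.ideal H.homogeneous

/-- The restriction `K[G] → K[H]`. -/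
def restrict : G.coord ⟶ H.coordRing := quotientMk _ _ _

theorem restrict_surjective : Function.Surjective H.restrict.toAlgHom :=
  quotientMk_surjective _ _ _

theorem restrict_mem : H.restrict ∈ H.points H.coordRing := fun a ha =>
  (quotientMk_eq_zero_iff _ _ _ a).mpr ha

theorem restrict_comp_mem {T : SAlg.{u} K} (f : H.coordRing ⟶ T) : H.restrict ≫ f ∈ H.points T :=
  H.map_mem_points f H.restrict_mem

/-- The morphism `K[H] → T` that corresponds to a point of `H`. -/
def factor {T : SAlg.{u} K} (h : G.coord ⟶ T) (hh : h ∈ H.points T) : H.coordRing ⟶ T :=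
  quotientDesc _ _ _ h hh

theorem restrict_factor {T : SAlg.{u} K} (h : G.coord ⟶ T) (hh : h ∈ H.points T) :
    H.restrict ≫ H.factor h hh = h := rfl

variable {H} in
theorem coordRing_hom_ext {T : SAlg.{u} K} {f g : H.coordRing ⟶ T}
    (h : H.restrict ≫ f = H.restrict ≫ g) : f = g := quotient_hom_ext h

/-- The point `g h` with `h` the generic point of `H`. -/
def translate {T : SAlg.{u} K} (g : G.coord ⟶ T) : G.coord ⟶ tensor T H.coordRing :=
  (g ≫ inl _ _) * (H.restrict ≫ inr _ _)

/-- The automorphism `c(y) ↦ c(h y)` of the functions on `H_T`. -/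
def twist {T : SAlg.{u} K} (h : G.coord ⟶ T) (hh : h ∈ H.points T) :
    tensor T H.coordRing ⟶ tensor T H.coordRing :=
  desc (inl _ _) (H.factor ((h ≫ inl _ _) * (H.restrict ≫ inr _ _))
    ((H.points _).mul_mem (H.map_mem_points _ hh) (H.restrict_comp_mem _)))

/-- The comultiplication `c(y) ↦ c(y z)` of the functions on `H_T`. -/
def comul (T : SAlg.{u} K) :
    tensor T H.coordRing ⟶ tensor (tensor T H.coordRing) H.coordRing :=
  desc (inl _ _ ≫ inl _ _)
    (H.factor ((H.restrict ≫ inr _ _ ≫ inl _ _) * (H.restrict ≫ inr _ _))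
      ((H.points _).mul_mem (H.restrict_comp_mem _) (H.restrict_comp_mem _)))

section

variable {S T : SAlg.{u} K}

theorem inl_twist (h : G.coord ⟶ T) (hh : h ∈ H.points T) :
    inl _ _ ≫ H.twist h hh = inl _ _ := inl_desc _ _

theorem restrict_inr_twist (h : G.coord ⟶ T) (hh : h ∈ H.points T) :
    H.restrict ≫ inr _ _ ≫ H.twist h hh = (h ≫ inl _ _) * (H.restrict ≫ inr _ _) := by
  rw [twist, inr_desc, restrict_factor]

theorem inl_comul : inl _ _ ≫ H.comul T = inl _ _ ≫ inl _ _ := inl_desc _ _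

theorem restrict_inr_comul : H.restrict ≫ inr _ _ ≫ H.comul T =
    (H.restrict ≫ inr _ _ ≫ inl _ _) * (H.restrict ≫ inr _ _) := by
  rw [comul, inr_desc, restrict_factor]

/-- Associativity h(yz) = (hy)z, for the generic points y and z of H. -/
theorem twist_comul (h : G.coord ⟶ T) (hh : h ∈ H.points T) :
    H.twist h hh ≫ H.comul T = H.comul T ≫ mapLeft _ (H.twist h hh) := by
  refine tensor_hom_ext ?_ (coordRing_hom_ext ?_)
  · rw [← Category.assoc, inl_twist, ← Category.assoc, inl_comul, Category.assoc, inl_mapLeft,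
      ← Category.assoc, inl_twist]
  · have h1 : H.restrict ≫ inr _ _ ≫ H.twist h hh ≫ H.comul T =
        (h ≫ inl _ _ ≫ inl _ _) * ((H.restrict ≫ inr _ _ ≫ inl _ _) * (H.restrict ≫ inr _ _)) := by
      have := congrArg (· ≫ H.comul T) (H.restrict_inr_twist h hh)
      simp only [Category.assoc, G.mul_comp, restrict_inr_comul, inl_comul] at this
      exact this
    have h2 : H.restrict ≫ inr _ _ ≫ H.comul T ≫ mapLeft _ (H.twist h hh) =
        ((h ≫ inl _ _ ≫ inl _ _) * (H.restrict ≫ inr _ _ ≫ inl _ _)) * (H.restrict ≫ inr _ _) := by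
      have := congrArg (· ≫ mapLeft _ (H.twist h hh)) (H.restrict_inr_comul (T := T))
      have h3 := congrArg (· ≫ inl _ H.coordRing) (H.restrict_inr_twist h hh)
      simp only [Category.assoc, G.mul_comp, inl_mapLeft, inr_mapLeft] at this h3
      rw [h3] at this
      exact this
    rw [h1, h2, mul_assoc]

theorem twist_twist_inv (h : G.coord ⟶ T) (hh : h ∈ H.points T) :
    H.twist h hh ≫ H.twist h⁻¹ ((H.points _).inv_mem hh) = 𝟙 _ := by
  refine tensor_hom_ext ?_ (coordRing_hom_ext ?_)
  · rw [← Category.assoc, inl_twist, inl_twist, Category.comp_id]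
  · calc H.restrict ≫ inr _ _ ≫ H.twist h hh ≫ H.twist h⁻¹ ((H.points _).inv_mem hh)
        = (H.restrict ≫ inr _ _ ≫ H.twist h hh) ≫ H.twist h⁻¹ ((H.points _).inv_mem hh) := by
          simp only [Category.assoc]
      _ = H.restrict ≫ inr _ _ := by
          rw [restrict_inr_twist, G.mul_comp, Category.assoc, inl_twist, Category.assoc,
            restrict_inr_twist, inv_comp, mul_inv_cancel_left]
      _ = _ := by rw [Category.comp_id]

theorem twist_inv_twist (h : G.coord ⟶ T) (hh : h ∈ H.points T) :
    H.twist h⁻¹ ((H.points _).inv_mem hh) ≫ H.twist h hh = 𝟙 _ := by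
  have := H.twist_twist_inv h⁻¹ ((H.points _).inv_mem hh)
  simpa only [inv_inv] using this

theorem translate_twist (g h : G.coord ⟶ T) (hh : h ∈ H.points T) :
    H.translate g ≫ H.twist h hh = H.translate (g * h) := by
  rw [translate, translate, G.mul_comp, G.mul_comp, Category.assoc, inl_twist, Category.assoc,
    restrict_inr_twist, mul_assoc]

theorem translate_mapLeft (g : G.coord ⟶ S) (u : S ⟶ T) :
    H.translate g ≫ mapLeft _ u = H.translate (g ≫ u) := by
  rw [translate, translate, G.mul_comp, Category.assoc, inl_mapLeft, Category.assoc,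
    inr_mapLeft, Category.assoc]

theorem mapLeft_comul (u : S ⟶ T) :
    mapLeft _ u ≫ H.comul T = H.comul S ≫ mapLeft _ (mapLeft _ u) := by
  refine tensor_hom_ext ?_ (coordRing_hom_ext ?_)
  · rw [← Category.assoc, inl_mapLeft, Category.assoc, inl_comul, ← Category.assoc (inl _ _),
      inl_comul, Category.assoc, inl_mapLeft, ← Category.assoc, ← Category.assoc, inl_mapLeft]
  · have := congrArg (· ≫ mapLeft _ (mapLeft _ u)) (H.restrict_inr_comul (T := S))
    have h3 : inr S H.coordRing ≫ mapLeft _ u ≫ H.comul T = inr _ _ ≫ H.comul T := by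
      rw [← Category.assoc, inr_mapLeft]
    have h4 : inr S H.coordRing ≫ mapLeft _ u ≫ inl (tensor T H.coordRing) H.coordRing =
        inr _ _ ≫ inl _ _ := by rw [← Category.assoc, inr_mapLeft]
    simp only [Category.assoc, G.mul_comp, inl_mapLeft, inr_mapLeft, h4] at this
    rw [h3, restrict_inr_comul, this]

theorem translate_apply_of_mem_invariants (g : G.coord ⟶ T) {b : G.coord}
    (hb : b ∈ H.invariantSubalgebra) :
    (H.translate g).toAlgHom b = (inl T H.coordRing).toAlgHom (g.toAlgHom b) :=
  hb _ _ _ (H.restrict_comp_mem _)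

end

/-! ### Integrals -/

section Integral

variable {S T : SAlg.{u} K} {ι : Type} (e : Module.Basis ι K H.coordRing)
  (p : ι → ZMod 2)

/-- The `T`-linear endomorphism `c ↦ c₁ e^j(c₂)` of the functions on `H_T`. -/
def convolve (T : SAlg.{u} K) (j : ι) : tensor T H.coordRing →ₗ[K] tensor T H.coordRing :=
  contract _ (e.coord j) ∘ₗ (H.comul T).toAlgHom.toLinearMap

theorem convolve_apply (j : ι) (z : tensor T H.coordRing) :
    H.convolve e T j z = contract _ (e.coord j) ((H.comul T).toAlgHom z) := rfl

theorem convolve_inl_mul (j : ι) (t : T) (z : tensor T H.coordRing) :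
    H.convolve e T j ((inl _ _).toAlgHom t * z) = (inl _ _).toAlgHom t * H.convolve e T j z := by
  rw [convolve_apply, convolve_apply, map_mul (H.comul T).toAlgHom, ← hom_comp_apply, inl_comul, hom_comp_apply,
    contract_inl_mul]

/-- Left translation acts on y in c(yz), while the convolution contracts the variable z, so the two
commute. -/
theorem convolve_twist (j : ι) (h : G.coord ⟶ T) (hh : h ∈ H.points T)
    (z : tensor T H.coordRing) : H.convolve e T j ((H.twist h hh).toAlgHom z) =
      (H.twist h hh).toAlgHom (H.convolve e T j z) := by
  rw [convolve_apply, convolve_apply, ← hom_comp_apply, twist_comul, hom_comp_apply, contract_mapLeft]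

theorem convolve_mapLeft (j : ι) (u : S ⟶ T) (z : tensor S H.coordRing) :
    H.convolve e T j ((mapLeft _ u).toAlgHom z) =
      (mapLeft _ u).toAlgHom (H.convolve e S j z) := by
  rw [convolve_apply, convolve_apply, ← hom_comp_apply, mapLeft_comul, hom_comp_apply, contract_mapLeft]

theorem convolve_mem (he : ∀ i, e i ∈ H.coordRing.grading (p i)) (j : ι) {d : ZMod 2} {z : tensor T H.coordRing}
    (hz : z ∈ (tensor T H.coordRing).grading d) :
    
    H.convolve e T j z ∈ (tensor T H.coordRing).grading (d + p j) :=
  contract_coord_mem e p he j ((H.comul T).map_mem _ _ hz)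

variable [Fintype ι]

/-- The integral on `H_T` that sends `w` to the supertrace of the endomorphism
`c ↦ c₁ e^j(c₂) w` of the functions on `H_T`. -/
def integral (T : SAlg.{u} K) (j : ι) : tensor T H.coordRing →ₗ[K] T :=
  -- For `w` of degree d, the parity power on `w` completes the weight to (-1)^(p i (1 + p j + d)),
  -- the supertrace sign of an endomorphism of degree p j + d. Written with `par`, the formula is
  -- linear in all `w`, homogeneous or not.
  ∑ i, sg K (p i * (1 + p j)) • (contract T (e.coord i) ∘ₗ
    LinearMap.mulLeft K (H.convolve e T j ((inr _ _).toAlgHom (e i))) ∘ₗ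
      ((tensor T H.coordRing).par (p i)).toAlgHom.toLinearMap)

theorem integral_apply (j : ι) (w : tensor T H.coordRing) :
    H.integral e p T j w = ∑ i, sg K (p i * (1 + p j)) • contract T (e.coord i)
      (H.convolve e T j ((inr _ _).toAlgHom (e i)) *
        ((tensor T H.coordRing).par (p i)).toAlgHom w) := by
  rw [integral, LinearMap.sum_apply]
  rfl

theorem integral_mapLeft (j : ι) (u : S ⟶ T) (w : tensor S H.coordRing) :
    H.integral e p T j ((mapLeft _ u).toAlgHom w) = u.toAlgHom (H.integral e p S j w) := by
  rw [integral_apply, integral_apply, map_sum]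
  refine Finset.sum_congr rfl fun i _ => ?_
  rw [map_smul, ← contract_mapLeft, map_mul (mapLeft _ u).toAlgHom, hom_par, ← convolve_mapLeft, ← hom_comp_apply (inr _ _),
    inr_mapLeft]

variable (he : ∀ i, e i ∈ H.coordRing.grading (p i))

include he

/-- The parity power `p i` applied to `w` cancels the one produced by contracting against e^i, so
right T-linearity holds without a sign. -/
theorem integral_mul_inl (j : ι) (w : tensor T H.coordRing) (t : T) :
    H.integral e p T j (w * (inl _ _).toAlgHom t) = H.integral e p T j w * t := by
  rw [integral_apply, integral_apply, Finset.sum_mul]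
  refine Finset.sum_congr rfl fun i _ => ?_
  rw [map_mul (par _ _).toAlgHom, ← hom_par, ← mul_assoc, contract_coord_mul_inl e p he, par_self, smul_mul_assoc]

/-- Here `t` carries the parity power `p i` and passes the convolution of e_i, of degree p i + p j;
only the power `p j` survives. -/
theorem integral_inl_mul (j : ι) (t : T) (w : tensor T H.coordRing) :
    H.integral e p T j ((inl _ _).toAlgHom t * w) =
      (T.par (p j)).toAlgHom t * H.integral e p T j w := by
  rw [integral_apply, integral_apply, Finset.mul_sum]
  refine Finset.sum_congr rfl fun i _ => ?_
  have h := H.convolve_mem e p he j ((inr T _).map_mem _ _ (he i))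
  rw [map_mul (par _ _).toAlgHom, ← mul_assoc, mul_eq_par_mul _ h, par_par, ← hom_par, mul_assoc, contract_inl_mul,
    mul_smul_comm]
  congr 4
  rw [add_right_comm, zmod_two_add_self, zero_add]

/-- The integrals are invariant under translations. -/
theorem integral_twist (j : ι) (h : G.coord ⟶ T) (hh : h ∈ H.points T)
    (w : tensor T H.coordRing) :
    H.integral e p T j ((H.twist h hh).toAlgHom w) = H.integral e p T j w := by
  induction w using homogeneous_induction with
  | hom d w hw =>
    have key : ∀ w ∈ (tensor T H.coordRing).grading d, H.integral e p T j w =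
        ∑ i, sg K (p i * (1 + (p j + d))) • contract T (e.coord i)
          (H.convolve e T j ((inr _ _).toAlgHom (e i)) * w) := by
      intro w hw
      rw [integral_apply]
      refine Finset.sum_congr rfl fun i _ => ?_
      rw [par_of_mem _ _ hw, mul_smul_comm, map_smul, smul_smul, ← sg_add]
      congr 2
      ring
    rw [key _ hw, key _ ((H.twist h hh).map_mem _ _ hw)]
    -- Cyclicity is used with X the inverse translation and Y the translation after c ↦ c₁ e^j(c₂)
    -- w. Then XY is the endomorphism for `w`, and YX the one for the translate of `w`, because
    -- convolution commutes with translation.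
    have := supertrace_comm e p he (H.twist h⁻¹ ((H.points _).inv_mem hh)) (H.inl_twist _ _)
      ((H.twist h hh).toAlgHom.toLinearMap ∘ₗ LinearMap.mulRight K w ∘ₗ H.convolve e T j)
      (fun t z => by
        simp only [LinearMap.comp_apply, LinearMap.mulRight_apply, AlgHom.toLinearMap_apply]
        rw [convolve_inl_mul, mul_assoc, map_mul, ← hom_comp_apply, inl_twist])
      (p j + d) (fun d' z hz => by
        simp only [LinearMap.comp_apply, LinearMap.mulRight_apply, AlgHom.toLinearMap_apply]
        rw [← add_assoc]
        exact (H.twist h hh).map_mem _ _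
          (SetLike.GradedMul.mul_mem (H.convolve_mem e p he j hz) hw))
    simp only [LinearMap.comp_apply, LinearMap.mulRight_apply, AlgHom.toLinearMap_apply] at this
    have h1 : ∀ z, (H.twist h⁻¹ ((H.points _).inv_mem hh)).toAlgHom ((H.twist h hh).toAlgHom z) = z := fun z => by
      rw [← hom_comp_apply, twist_twist_inv, hom_id_apply]
    have h2 : ∀ z, (H.twist h hh).toAlgHom ((H.twist h⁻¹ ((H.points _).inv_mem hh)).toAlgHom z) = z := fun z => by
      rw [← hom_comp_apply, twist_inv_twist, hom_id_apply]
    simp only [h1, map_mul, ← convolve_twist, h2] at this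
    exact this.symm
  | add x y hx hy => rw [map_add, map_add, map_add, hx, hy]

omit he in
/-- The antipode of `K[H]`. -/
def antipode : H.coordRing ⟶ H.coordRing := H.factor H.restrict⁻¹ ((H.points _).inv_mem H.restrict_mem)

omit he in
/-- The counit of `K[H]`. -/
def counit : H.coordRing ⟶ unit K := H.factor 1 ((H.points _).one_mem)

/-- The integrals recover the value of a function at the identity of `H`. -/
theorem sum_integral_antipode (g : G.coord ⟶ T) (a : G.coord) :
    ∑ j, H.integral e p T j ((inr _ _).toAlgHom (H.antipode.toAlgHom (e j)) *
      (H.translate g).toAlgHom a) = g.toAlgHom a := by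
  -- The antipode identity c₁ S(c₂) = ε(c), read off from y y⁻¹ = 1 for the generic point y of H.
  have hconv : inr T H.coordRing ≫ H.comul T ≫ desc (𝟙 _) (H.antipode ≫ inr _ _) =
      H.counit ≫ unitHom _ := by
    refine coordRing_hom_ext ?_
    have h1 := congrArg (· ≫ desc (𝟙 _) (H.antipode ≫ inr _ _)) (H.restrict_inr_comul (T := T))
    simp only [Category.assoc, G.mul_comp, inl_desc, inr_desc, Category.comp_id] at h1
    rw [h1, ← Category.assoc _ H.antipode, antipode, restrict_factor, inv_comp, mul_inv_cancel,
      ← Category.assoc, counit, restrict_factor, one_comp]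
  obtain ⟨c, hc, hc0⟩ : ∃ c : ι → K, (∀ i (R : SAlg.{u} K),
      (H.counit ≫ unitHom R).toAlgHom (e i) = algebraMap K R (c i)) ∧ ∀ i, p i = 1 → c i = 0 :=
    ⟨fun i => H.counit.toAlgHom (e i), fun _ _ => rfl,
      fun i hi => eq_zero_of_odd_of_unit H.counit (hi ▸ he i)⟩
  -- The sum over j of c₁ e^j(c₂) S(e_j) is c₁ S(c₂) = ε(c). The sum of the integrals is therefore
  -- the supertrace of c ↦ ε(c) w, with value ε(w).
  have hterm : ∀ i, ∑ j, H.convolve e T j ((inr _ _).toAlgHom (e i)) *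
      (inr _ _).toAlgHom (H.antipode.toAlgHom (e j)) =
        algebraMap K _ (c i) := fun i => by
    have h1 := sum_contract_mul e (𝟙 _) (H.antipode ≫ inr T _)
      ((H.comul T).toAlgHom ((inr _ _).toAlgHom (e i)))
    simp only [hom_id_apply] at h1
    refine h1.trans ?_
    rw [← hom_comp_apply, ← hom_comp_apply, hconv, hc]
  -- Evaluating g·h at h = 1 returns g.
  have hfin : H.translate g ≫ desc (𝟙 T) (H.counit ≫ unitHom T) = g := by
    rw [translate, G.mul_comp, Category.assoc, inl_desc, Category.comp_id, Category.assoc,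
      inr_desc, ← Category.assoc, counit, restrict_factor, one_comp, mul_one]
  conv_rhs => rw [← hfin]
  rw [hom_comp_apply, ← sum_contract_mul e]
  simp only [integral_apply]
  rw [Finset.sum_comm]
  refine Finset.sum_congr rfl fun i _ => ?_
  have h1 : ∀ j, sg K (p i * (1 + p j)) • contract T (e.coord i)
      (H.convolve e T j ((inr _ _).toAlgHom (e i)) *
        ((tensor T H.coordRing).par (p i)).toAlgHom
          ((inr _ _).toAlgHom (H.antipode.toAlgHom (e j)) * (H.translate g).toAlgHom a)) =
      sg K (p i) • contract T (e.coord i) ((H.convolve e T j ((inr _ _).toAlgHom (e i)) *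
        (inr _ _).toAlgHom (H.antipode.toAlgHom (e j))) *
        (H.translate g).toAlgHom ((G.coord.par (p i)).toAlgHom a)) := fun j => by
    rw [map_mul (par _ _).toAlgHom, par_of_mem _ _ ((inr T _).map_mem _ _ (H.antipode.map_mem _ _ (he j))),
      smul_mul_assoc, mul_smul_comm, map_smul, smul_smul, ← sg_add, hom_par, mul_assoc]
    congr 2
    generalize p i = x
    generalize p j = y
    clear hfin hconv hterm
    revert x y
    decide
  rw [Finset.sum_congr rfl fun j _ => h1 j, ← Finset.smul_sum, ← map_sum, ← Finset.sum_mul, hterm,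
    ← Algebra.smul_def, map_smul, hc, hom_id_apply, ← Algebra.commutes, ← Algebra.smul_def]
  -- For odd e_i the counit vanishes, so the remaining supertrace sign and parity power play no
  -- role.
  rcases zmod_two_cases (p i) with h | h
  · rw [h, sg_zero, one_smul, par_zero]
  · rw [hc0 i h, zero_smul, smul_zero, zero_smul]

end Integral

end ClosedSubgroup

end AffineSupergroup

/-! ### Averaging over H: the dual basis of K[G] over K[G]^H, and the fibres of the quotient -/

namespace AffineSupergroup

open SAlg

variable {G : AffineSupergroup.{u} K} [NeZero (2 : K)]

theorem inl_mul_inr_desc {R : SAlg.{u} K} (g h : G.coord ⟶ R) :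
    (inl G.coord G.coord * inr G.coord G.coord) ≫ desc g h = g * h := by
  rw [G.mul_comp, inl_desc, inr_desc]

/-- Left multiplication by a `T`-point commutes with maps that are `T`-linear on the right. -/
theorem linearMap_mul_apply {T D : SAlg.{u} K} (ι : T ⟶ D) (Θ : D →ₗ[K] T)
    (hΘ : ∀ w t, Θ (w * ι.toAlgHom t) = Θ w * t) (y : G.coord ⟶ D) (g : G.coord ⟶ T)
    (hy : ∀ a, Θ (y.toAlgHom a) = g.toAlgHom a) (h : G.coord ⟶ T) (x : G.coord) :
    Θ (((h ≫ ι) * y).toAlgHom x) = (h * g).toAlgHom x := by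
  -- Both products factor through the comultiplication of K[G], the product of the two universal
  -- points. On a pure tensor, the factor from `h` is moved to the right, where Θ is T-linear, and
  -- then back.
  rw [← inl_mul_inr_desc (h ≫ ι), ← inl_mul_inr_desc h, hom_comp_apply, hom_comp_apply]
  generalize (inl G.coord G.coord * inr G.coord G.coord).toAlgHom x = z
  induction z using tensor_induction with
  | tmul a b =>
    rw [desc_tmul, desc_tmul]
    induction b using homogeneous_induction with
    | hom i b hb =>
      rw [mul_eq_mul_par _ (y.map_mem i b hb), hom_comp_apply, ← hom_par, hΘ, hy,
        ← mul_eq_mul_par _ (g.map_mem i b hb)]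
    | add b c hb hc => simp only [map_add, mul_add, hb, hc]
  | add x y hx hy => simp only [map_add, hx, hy]

namespace ClosedSubgroup

variable (H : G.ClosedSubgroup)

/-- Since h = g⁻¹(gh), a function of h is a sum of products of functions of g with functions of gh.
-/
theorem exists_inr_eq (c : H.coordRing) : ∃ z : tensor G.coord G.coord,
    (desc (inl G.coord H.coordRing) (H.translate (𝟙 _))).toAlgHom z = (inr _ _).toAlgHom c := by
  obtain ⟨x, rfl⟩ := H.restrict_surjective c
  refine ⟨((inl G.coord G.coord)⁻¹ * inr G.coord G.coord).toAlgHom x, ?_⟩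
  rw [← hom_comp_apply, ← hom_comp_apply, G.mul_comp, inv_comp, inl_desc, inr_desc, translate,
    Category.id_comp, inv_mul_cancel_left]

variable {ι : Type} [Fintype ι] (e : Module.Basis ι K H.coordRing) (p : ι → ZMod 2)

theorem apply_integral_translate {T : SAlg.{u} K} (g : G.coord ⟶ T) (j : ι) (y : G.coord) :
    g.toAlgHom (H.integral e p G.coord j ((H.translate (𝟙 _)).toAlgHom y)) =
      H.integral e p T j ((H.translate g).toAlgHom y) := by
  rw [← integral_mapLeft, ← hom_comp_apply, translate_mapLeft, Category.id_comp]

variable (he : ∀ i, e i ∈ H.coordRing.grading (p i))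

include he

/-- The average of y(gh') over h' is invariant under g ↦ gh, since this substitution left-translates
the integrand by h. -/
theorem integral_translate_mem (j : ι) (y : G.coord) :
    H.integral e p G.coord j ((H.translate (𝟙 _)).toAlgHom y) ∈ H.invariantSubalgebra := by
  intro B g h hh
  rw [apply_integral_translate, apply_integral_translate, ← translate_twist H g h hh,
    hom_comp_apply, integral_twist H e p he]

theorem integral_translate_mul (j : ι) (y : G.coord) {b : G.coord}
    (hb : b ∈ H.invariantSubalgebra) :
    H.integral e p G.coord j ((H.translate (𝟙 _)).toAlgHom (y * b)) =
      H.integral e p G.coord j ((H.translate (𝟙 _)).toAlgHom y) * b := by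
  rw [map_mul, translate_apply_of_mem_invariants H _ hb, integral_mul_inl H e p he]
  rfl

/-- A finite dual basis of `K[G]` over `K[G]^H`. -/
theorem exists_dualBasis : ∃ (I : Type) (_ : Fintype I) (a b : I → G.coord) (j : I → ι),
    ∀ x, ∑ m, a m * H.integral e p G.coord (j m) ((H.translate (𝟙 _)).toAlgHom (b m * x)) = x := by
  have key : ∀ (j : ι) (z : tensor G.coord G.coord), ∃ (I : Type) (_ : Fintype I)
      (a b : I → G.coord), ∀ x, H.integral e p G.coord j
        ((desc (inl G.coord H.coordRing) (H.translate (𝟙 _))).toAlgHom z *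
          (H.translate (𝟙 _)).toAlgHom x) =
        ∑ m, a m * H.integral e p G.coord j ((H.translate (𝟙 _)).toAlgHom (b m * x)) := by
    intro j z
    induction z using tensor_induction with
    | tmul a b =>
      refine ⟨Unit, inferInstance, fun _ => (par _ (p j)).toAlgHom a, fun _ => b, fun x => ?_⟩
      rw [desc_tmul, mul_assoc, integral_inl_mul H e p he, Fintype.sum_unique, ← map_mul]
    | add z z' hz hz' =>
      obtain ⟨I, _, a, b, h⟩ := hz
      obtain ⟨I', _, a', b', h'⟩ := hz'
      refine ⟨I ⊕ I', inferInstance, Sum.elim a a', Sum.elim b b', fun x => ?_⟩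
      rw [map_add, add_mul, map_add, h, h', Fintype.sum_sum_type]
      rfl
  -- S(e_j)(h) is rewritten through functions of g and of gh; the former come out of the integral,
  -- leaving averages of products b_m x.
  choose z hz using fun j => H.exists_inr_eq (H.antipode.toAlgHom (e j))
  choose I hI a b h using fun j => key j (z j)
  refine ⟨Σ j, I j, inferInstance, fun m => a m.1 m.2, fun m => b m.1 m.2, fun m => m.1,
    fun x => ?_⟩
  rw [Fintype.sum_sigma]
  conv_rhs => rw [← hom_id_apply _ x, ← H.sum_integral_antipode e p he (𝟙 _) x]
  exact Finset.sum_congr rfl fun j _ => by rw [← h j x, hz j]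

omit he e in
variable (G) in
theorem finiteDimensional_coordRing [FiniteDimensional K G.coord] :
    FiniteDimensional K H.coordRing :=
  Module.Finite.of_surjective H.restrict.toAlgHom.toLinearMap H.restrict_surjective

end ClosedSubgroup

namespace ClosedSubgroup

variable (H : G.ClosedSubgroup) [FiniteDimensional K G.coord]

/-- Points of `G` with the same restriction to `K[G]^H` differ by a point of `H`. -/
theorem inv_mul_mem_points {T : SAlg.{u} K} (g g' : G.coord ⟶ T)
    (h : H.invariantsIncl ≫ g = H.invariantsIncl ≫ g') : g⁻¹ * g' ∈ H.points T := by
  have := H.finiteDimensional_coordRing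
  obtain ⟨ι, _, e, p, he⟩ := exists_homogeneousBasis H.coordRing
  obtain ⟨I, _, a, b, j, hab⟩ := H.exists_dualBasis e p he
  have hg : ∀ x ∈ H.invariantSubalgebra, g.toAlgHom x = g'.toAlgHom x := fun x hx =>
    congrArg (fun f : H.invariants ⟶ T => f.toAlgHom ⟨x, hx⟩) h
  -- Θ evaluates the dual basis identity with the outer factors at g' and the integrands at gh. The
  -- averages are invariant functions, on which g and g' agree, so the result on x(gh) is x(g').
  let Θ : tensor T H.coordRing →ₗ[K] T := ∑ m, LinearMap.mulLeft K (g'.toAlgHom (a m)) ∘ₗ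
    H.integral e p T (j m) ∘ₗ LinearMap.mulLeft K ((H.translate g).toAlgHom (b m))
  have hΘ : ∀ w, Θ w = ∑ m, g'.toAlgHom (a m) *
      H.integral e p T (j m) ((H.translate g).toAlgHom (b m) * w) := fun w => by
    simp only [Θ, LinearMap.sum_apply]; rfl
  have hΘ' : ∀ x, Θ ((H.translate g).toAlgHom x) = g'.toAlgHom x := fun x => by
    conv_rhs => rw [← hab x]
    rw [hΘ, map_sum]
    refine Finset.sum_congr rfl fun m _ => ?_
    rw [map_mul g'.toAlgHom, ← hg _ (H.integral_translate_mem e p he _ _),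
      apply_integral_translate, map_mul (H.translate g).toAlgHom]
  intro x hx
  -- Left multiplication by g⁻¹ turns this into Θ(x(h)) = x(g⁻¹g'), and x(h) = 0 for x in I_H.
  rw [← linearMap_mul_apply (inl T H.coordRing) Θ (fun w t => by
    rw [hΘ, hΘ, Finset.sum_mul]
    refine Finset.sum_congr rfl fun m _ => ?_
    rw [← mul_assoc, H.integral_mul_inl e p he, mul_assoc]) _ _ hΘ', translate, inv_comp,
    inv_mul_cancel_left, H.restrict_comp_mem _ x hx, map_zero]

end ClosedSubgroup

end AffineSupergroup

/-! ### Faithful flatness from dual bases -/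

section FaithfullyFlat

variable {R : SAlg.{u} K} {B : Type u} [Ring B] [Algebra K B] {φ : R →ₐ[K] B}

/-- The map `B ⊗_R M → M` given by an `R`-linear map `B → R`. -/
def BaseChange.eval (π : B →ₗ[K] R) (hπ : ∀ x r, π (x * φ r) = π x * r) (M : SMod R) :
    BaseChange φ M →ₗ[K] M :=
  BaseChange.lift ((LinearMap.mk₂ K (fun (r : R) (m : M) => r • m) (fun _ _ _ => add_smul _ _ _)
    (fun _ _ _ => smul_assoc _ _ _) (fun _ _ _ => smul_add _ _ _)
    (fun c r m => smul_comm r c m)).comp π) fun b r m => by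
      simp only [LinearMap.comp_apply, LinearMap.mk₂_apply, hπ, mul_smul]

theorem BaseChange.eval_tmul (π : B →ₗ[K] R) (hπ : ∀ x r, π (x * φ r) = π x * r) {M : SMod R}
    (b : B) (m : M) : BaseChange.eval π hπ M (BaseChange.tmul φ M b m) = π b • m := rfl

theorem BaseChange.eval_map (π : B →ₗ[K] R) (hπ : ∀ x r, π (x * φ r) = π x * r) {M N : SMod R}
    (f : SMod.Hom M N) (z : BaseChange φ M) :
    BaseChange.eval π hπ N (baseChangeMap φ f z) = f.toLinearMap (BaseChange.eval π hπ M z) := by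
  induction z using BaseChange.induction with
  | tmul b m => rw [baseChangeMap_tmul, eval_tmul, eval_tmul, map_smul]
  | add x y hx hy => simp only [map_add, hx, hy]

/-- A direct summand of a finite free right module that contains the base ring as a direct
summand is faithfully flat. -/
theorem isFaithfullyFlat_of_dualBasis {I : Type} [Fintype I] (a : I → B) (ψ : I → B →ₗ[K] R)
    (hψ : ∀ m x r, ψ m (x * φ r) = ψ m x * r) (hab : ∀ x, ∑ m, a m * φ (ψ m x) = x)
    (π : B →ₗ[K] R) (hπ : ∀ x r, π (x * φ r) = π x * r) (h1 : π 1 = 1) : IsFaithfullyFlat φ := by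
  intro M' M M'' f g
  -- The dual basis identity tensored with M: `z` is determined by its coordinates in M, so
  -- exactness lifts from M coordinate by coordinate.
  have hz : ∀ (M : SMod R) (z : BaseChange φ M),
      ∑ m, BaseChange.tmul φ M (a m) (BaseChange.eval (ψ m) (hψ m) M z) = z := by
    intro M z
    induction z using BaseChange.induction with
    | tmul b x =>
      conv_rhs => rw [← hab b]
      rw [map_sum, LinearMap.sum_apply]
      refine Finset.sum_congr rfl fun m _ => ?_
      rw [BaseChange.eval_tmul, BaseChange.tmul_smul]
    | add x y hx hy =>
      simp only [map_add, Finset.sum_add_distrib, hx, hy]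
  constructor
  · intro h z
    constructor
    · intro hgz
      have h2 : ∀ m, ∃ y, f.toLinearMap y = BaseChange.eval (ψ m) (hψ m) M z := fun m => by
        refine (h _).mp ?_
        rw [← BaseChange.eval_map, hgz, map_zero]
      choose y hy using h2
      refine ⟨∑ m, BaseChange.tmul φ M' (a m) (y m), ?_⟩
      rw [map_sum, ← hz M z]
      refine Finset.sum_congr rfl fun m _ => ?_
      rw [baseChangeMap_tmul, hy]
    · rintro ⟨y, rfl⟩
      induction y using BaseChange.induction with
      | tmul b m => rw [baseChangeMap_tmul, baseChangeMap_tmul, h.apply_apply_eq_zero, map_zero]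
      | add x y hx hy => rw [map_add, map_add, hx, hy, add_zero]
  · intro h x
    -- The map induced by π retracts x ↦ 1 ⊗ x naturally in M, so exactness descends.
    have hx : ∀ (M : SMod R) (x : M),
        BaseChange.eval π hπ M (BaseChange.tmul φ M 1 x) = x := fun M x => by
      rw [BaseChange.eval_tmul, h1, one_smul]
    constructor
    · intro hgx
      obtain ⟨y, hy⟩ := (h (BaseChange.tmul φ M 1 x)).mp (by
        rw [baseChangeMap_tmul, hgx, map_zero])
      exact ⟨BaseChange.eval π hπ M' y, by rw [← BaseChange.eval_map, hy, hx]⟩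
    · rintro ⟨y, rfl⟩
      have h2 := h.apply_apply_eq_zero (BaseChange.tmul φ M' 1 y)
      rw [baseChangeMap_tmul, baseChangeMap_tmul] at h2
      rw [← hx M'' (g.toLinearMap _), h2, map_zero]

end FaithfullyFlat

namespace SAlg

/-! ### The even part -/

/-- The subalgebra of even elements. -/
def evenPart (R : SAlg.{u} K) : Subalgebra K R where
  carrier := R.grading 0
  mul_mem' {a b} ha hb := by
    have := SetLike.GradedMul.mul_mem (A := R.grading) ha hb
    rwa [add_zero] at this
  add_mem' := add_mem
  algebraMap_mem' c := by
    rw [Algebra.algebraMap_eq_smul_one]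
    exact Submodule.smul_mem _ _ (SetLike.GradedOne.one_mem (A := R.grading))

instance (R : SAlg.{u} K) : CommRing R.evenPart :=
  { (inferInstance : Ring R.evenPart) with
    mul_comm := fun a b => Subtype.ext (by
      change (a : R) * b = b * a
      rw [R.mul_eq_par_mul a.2, par_zero]) }

/-! ### Splitting off the base ring by Nakayama's lemma over its even part -/

section Retraction

variable {R A : SAlg.{u} K} (ι : R ⟶ A)

/-- The left ideal of the values at `1` of the right `R`-linear maps `A → R`. -/
def valueIdeal : Ideal R where
  carrier := {r | ∃ π : A →ₗ[K] R, (∀ x r, π (x * ι.toAlgHom r) = π x * r) ∧ π 1 = r}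
  zero_mem' := ⟨0, fun _ _ => by simp, rfl⟩
  add_mem' := by
    rintro _ _ ⟨π, hπ, rfl⟩ ⟨π', hπ', rfl⟩
    exact ⟨π + π', fun x r => by simp [hπ, hπ', add_mul], rfl⟩
  smul_mem' := by
    rintro c _ ⟨π, hπ, rfl⟩
    exact ⟨LinearMap.mulLeft K c ∘ₗ π, fun x r => by simp [hπ, mul_assoc], rfl⟩

/-- Conjugating π by the parity automorphisms keeps it right linear and applies parity to its value
at 1. -/
theorem par_mem_valueIdeal {r : R} (hr : r ∈ valueIdeal ι) :
    (R.par 1).toAlgHom r ∈ valueIdeal ι := by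
  obtain ⟨π, hπ, rfl⟩ := hr
  refine ⟨(R.par 1).toAlgHom.toLinearMap ∘ₗ π ∘ₗ (A.par 1).toAlgHom.toLinearMap, fun x r => ?_, ?_⟩
  · simp only [LinearMap.comp_apply, AlgHom.toLinearMap_apply]
    rw [map_mul, ← hom_par, hπ, map_mul, par_self]
  · simp

variable [NeZero (2 : K)]

theorem odd_mul_self (R : SAlg.{u} K) {b : R} (hb : b ∈ R.grading 1) : b * b = 0 := by
  have h := R.supercomm_smul hb hb
  rw [mul_one, sg_one, neg_one_smul, eq_neg_iff_add_eq_zero, ← two_smul K] at h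
  exact (smul_eq_zero_iff_right (NeZero.ne 2)).mp h

theorem odd_mul_odd_sq (R : SAlg.{u} K) {b c : R} (hb : b ∈ R.grading 1) (hc : c ∈ R.grading 1) :
    (b * c) * (b * c) = 0 := by
  rw [mul_assoc, ← mul_assoc c, R.supercomm_smul hc hb, smul_mul_assoc, mul_smul_comm, mul_assoc b,
    R.odd_mul_self hc, mul_zero, mul_zero, smul_zero]

/-- If `A` is a finite projective right `R`-module, then `R` is a direct summand of it. -/
theorem exists_retraction [FiniteDimensional K A] (hι : Function.Injective ι.toAlgHom)
    {I : Type} [Fintype I] (a : I → A) (ψ : I → A →ₗ[K] R)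
    (hψ : ∀ m x r, ψ m (x * ι.toAlgHom r) = ψ m x * r)
    (hab : ∀ x, ∑ m, a m * ι.toAlgHom (ψ m x) = x) :
    ∃ π : A →ₗ[K] R, (∀ x r, π (x * ι.toAlgHom r) = π x * r) ∧ π 1 = 1 := by
  suffices h : (1 : R) ∈ valueIdeal ι from h
  have hJ := homogeneous_of_par R (valueIdeal ι) fun r hr => par_mem_valueIdeal ι hr
  let E := R.evenPart
  let f : E →+* A := ι.toAlgHom.toRingHom.comp E.val.toRingHom
  let _ : Module E A := Module.compHom A f
  have smul_def : ∀ (r : E) (x : A), r • x = ι.toAlgHom r * x := fun _ _ => rfl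
  have : IsScalarTower K E A := ⟨fun c r x => by
    rw [smul_def, smul_def, ← smul_mul_assoc, ← map_smul]; rfl⟩
  have : Module.Finite E A := Module.Finite.of_restrictScalars_finite K E A
  -- The aim is A = (J₀ + J₁)A, with J₁ generated by products of two odd elements and hence nil.
  -- Nakayama then puts 1 in J₀ + J₁, and nilpotence puts it in J₀.
  let J₀ : Ideal E := (valueIdeal ι).comap E.val.toRingHom
  let J₁ : Ideal E := Ideal.span {x | ∃ b ∈ R.grading 1, ∃ c ∈ R.grading 1, (x : R) = b * c}
  let N : Submodule E A := (J₀ ⊔ J₁) • ⊤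
  have hmul : ∀ x ∈ N, ∀ y, x * y ∈ N := fun x hx y => by
    induction hx using Submodule.smul_induction_on' with
    | smul r hr n hn =>
      rw [smul_def, mul_assoc, ← smul_def]
      exact Submodule.smul_mem_smul hr trivial
    | add x hx y hy h1 h2 => rw [add_mul]; exact N.add_mem h1 h2
  have heven : ∀ r : E, r ∈ J₀ ⊔ J₁ → ∀ x, x * ι.toAlgHom r ∈ N := fun r hr x => by
    have : x * ι.toAlgHom r = r • x := by
      rw [smul_def, A.mul_eq_par_mul (ι.map_mem 0 _ r.2), par_zero]
    rw [this]
    exact Submodule.smul_mem_smul hr trivial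
  -- Expand 1 in the dual basis and multiply by x. The elements ψ_m(1) lie in the value ideal, so
  -- their even components contribute to N and only odd coefficients remain; a second application
  -- makes these products of two odd elements.
  have hstep : ∀ x : A, ∃ n ∈ N, x = n + ∑ m, x * a m * ι.toAlgHom (R.component 1 (ψ m 1)) := by
    intro x
    refine ⟨∑ m, x * a m * ι.toAlgHom (R.component 0 (ψ m 1)), N.sum_mem fun m _ => ?_, ?_⟩
    · exact heven ⟨_, R.component_mem 0 _⟩
        (Ideal.mem_sup_left (hJ (ψ m 1) ⟨ψ m, hψ m, rfl⟩ 0 :)) _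
    · rw [← Finset.sum_add_distrib]
      simp only [← mul_add, ← map_add, R.component_zero_add_one, mul_assoc]
      rw [← Finset.mul_sum, hab, mul_one]
  have htop : (⊤ : Submodule E A) ≤ (J₀ ⊔ J₁) • ⊤ := by
    intro x _
    obtain ⟨n, hn, hx⟩ := hstep x
    rw [hx]
    refine N.add_mem hn (N.sum_mem fun m _ => ?_)
    obtain ⟨n', hn', hx'⟩ := hstep (x * a m)
    rw [hx', add_mul, Finset.sum_mul]
    refine N.add_mem (hmul _ hn' _) (N.sum_mem fun k _ => ?_)
    rw [mul_assoc, ← map_mul]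
    have hb := R.component_mem 1 (ψ k 1)
    have hc := R.component_mem 1 (ψ m 1)
    exact heven ⟨_, SetLike.GradedMul.mul_mem (A := R.grading) hb hc⟩
      (Ideal.mem_sup_right (Ideal.subset_span ⟨_, hb, _, hc, rfl⟩)) _
  -- Nakayama gives r ≡ 1 modulo J₀ + J₁ with rA = 0; applying it to 1 and using injectivity gives r
  -- = 0.
  obtain ⟨r, hr, hr0⟩ := Submodule.exists_sub_one_mem_and_smul_eq_zero_of_fg_of_le_smul
    (J₀ ⊔ J₁) (⊤ : Submodule E A) Module.Finite.fg_top htop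
  have h0 : r = 0 := Subtype.ext (hι (by
    have := hr0 1 trivial
    rw [smul_def, mul_one] at this
    rw [this]; exact (map_zero _).symm))
  rw [h0, zero_sub, neg_mem_iff] at hr
  obtain ⟨x, hx, n, hn, hxn⟩ := Submodule.mem_sup.mp hr
  have hnil : J₁ ≤ nilradical E := by
    refine Ideal.span_le.mpr ?_
    rintro y ⟨b, hb, c, hc, hy⟩
    refine ⟨2, Subtype.ext ?_⟩
    rw [pow_two]
    change (y : R) * y = 0
    rw [hy, R.odd_mul_odd_sq hb hc]
  have hu : IsUnit x := by
    rw [eq_sub_of_add_eq hxn]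
    exact IsNilpotent.isUnit_one_sub (hnil hn)
  exact (Ideal.eq_top_iff_one J₀).mp (Ideal.eq_top_of_isUnit_mem J₀ hx hu)

end Retraction

end SAlg

namespace AffineSupergroup.ClosedSubgroup

open SAlg

variable [NeZero (2 : K)] {G : AffineSupergroup.{u} K} (H : G.ClosedSubgroup)
  [FiniteDimensional K G.coord]

/-- `K[G]` is faithfully flat over `K[G]^H`. -/
theorem ffCoverings_invariantsIncl :
    ffCoverings H.invariants 1 (fun _ => G.coord) fun _ => H.invariantsIncl := by
  have := H.finiteDimensional_coordRing
  obtain ⟨ι, _, e, p, he⟩ := exists_homogeneousBasis H.coordRing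
  obtain ⟨I, _, a, b, j, hab⟩ := H.exists_dualBasis e p he
  let ψ : I → G.coord →ₗ[K] H.invariants := fun m =>
    LinearMap.codRestrict (Subalgebra.toSubmodule H.invariantSubalgebra)
      (H.integral e p G.coord (j m) ∘ₗ (H.translate (𝟙 _)).toAlgHom.toLinearMap ∘ₗ
        LinearMap.mulLeft K (b m)) fun x => H.integral_translate_mem e p he _ _
  have hψ : ∀ m x r, ψ m (x * H.invariantsIncl.toAlgHom r) = ψ m x * r := fun m x r =>
    Subtype.ext (by
      refine Eq.trans ?_ (H.integral_translate_mul e p he (j m) (b m * x) r.2)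
      rw [mul_assoc]
      rfl)
  have hab' : ∀ x, ∑ m, a m * H.invariantsIncl.toAlgHom (ψ m x) = x := hab
  obtain ⟨π, hπ, h1⟩ := exists_retraction H.invariantsIncl Subtype.val_injective a ψ hψ hab'
  -- The covering has a single member, so its product is K[G] up to this identification.
  let ev : (Fin 1 → G.coord) →ₗ[K] G.coord := LinearMap.proj 0
  refine isFaithfullyFlat_of_dualBasis (fun m _ => a m) (fun m => ψ m ∘ₗ ev)
    (fun m x r => hψ m (x 0) r) (fun x => ?_) (π ∘ₗ ev) (fun x r => hπ (x 0) r) h1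
  funext k
  rw [Subsingleton.elim k 0, Finset.sum_apply]
  exact hab' (x 0)

end AffineSupergroup.ClosedSubgroup

namespace SAlg

/-! ### Free superalgebras -/

section Free

variable (K) {X : Type} (p : X → ZMod 2)

/-- The relations of supercommutativity on the generators. -/
def freeRel (a b : FreeAlgebra K X) : Prop :=
  ∃ x y, a = FreeAlgebra.ι K x * FreeAlgebra.ι K y ∧
    b = sg K (p x * p y) • (FreeAlgebra.ι K y * FreeAlgebra.ι K x)

/-- The underlying algebra of the free superalgebra. -/
def FreeCarrier : Type u := RingQuot (freeRel K p)

instance : Ring (FreeCarrier K p) := inferInstanceAs (Ring (RingQuot (freeRel K p)))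

instance : Algebra K (FreeCarrier K p) := inferInstanceAs (Algebra K (RingQuot (freeRel K p)))

variable {K}

/-- The projection from the free algebra to the free superalgebra. -/
def freeMk : FreeAlgebra K X →ₐ[K] FreeCarrier K p := RingQuot.mkAlgHom K (freeRel K p)

/-- A generator of the free superalgebra. -/
def freeGen (x : X) : FreeCarrier K p := freeMk p (FreeAlgebra.ι K x)

theorem freeGen_mul (x y : X) : freeGen (K := K) p x * freeGen p y =
    sg K (p x * p y) • (freeGen p y * freeGen p x) := by
  have : freeMk p _ = freeMk p _ :=
    RingQuot.mkAlgHom_rel (S := K) (show freeRel K p _ _ from ⟨x, y, rfl, rfl⟩)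
  rwa [map_mul, map_smul, map_mul] at this

/-- The morphism from the free superalgebra given by the images of the generators. -/
def freeLift {S : Type*} [Ring S] [Algebra K S] (s : X → S)
    (hs : ∀ x y, s x * s y = sg K (p x * p y) • (s y * s x)) : FreeCarrier K p →ₐ[K] S :=
  RingQuot.liftAlgHom K ⟨FreeAlgebra.lift K s, by
    rintro _ _ ⟨x, y, rfl, rfl⟩
    simp [hs x y]⟩

theorem freeLift_gen {S : Type*} [Ring S] [Algebra K S] (s : X → S)
    (hs : ∀ x y, s x * s y = sg K (p x * p y) • (s y * s x)) (x : X) :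
    freeLift p s hs (freeGen p x) = s x := by
  exact (RingQuot.liftAlgHom_mkAlgHom_apply K _ _ _).trans (FreeAlgebra.lift_ι_apply s x)

theorem freeCarrier_algHom_ext {S : Type*} [Ring S] [Algebra K S] {f g : FreeCarrier K p →ₐ[K] S}
    (h : ∀ x, f (freeGen p x) = g (freeGen p x)) : f = g :=
  RingQuot.ringQuot_ext' K f g (FreeAlgebra.hom_ext (funext h))

@[elab_as_elim]
theorem freeCarrier_induction {q : FreeCarrier K p → Prop} (scalar : ∀ c, q (algebraMap K _ c))
    (gen : ∀ x, q (freeGen p x)) (mul : ∀ a b, q a → q b → q (a * b))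
    (add : ∀ a b, q a → q b → q (a + b)) (a : FreeCarrier K p) : q a := by
  obtain ⟨a, rfl⟩ : ∃ b, freeMk p b = a := RingQuot.mkAlgHom_surjective K (freeRel K p) a
  induction a using FreeAlgebra.induction with
  | grade0 r => rw [AlgHom.commutes]; exact scalar r
  | grade1 x => exact gen x
  | mul a b ha hb => rw [map_mul]; exact mul _ _ ha hb
  | add a b ha hb => rw [map_add]; exact add _ _ ha hb

/-- The parity automorphism of the free superalgebra. -/
def freePar : FreeCarrier K p →ₐ[K] FreeCarrier K p :=
  freeLift p (fun x => sg K (p x) • freeGen p x) fun x y => by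
    rw [smul_mul_smul_comm, smul_mul_smul_comm, freeGen_mul, smul_smul, smul_smul,
      mul_comm (sg K (p x)), mul_comm (sg K (p x * p y))]

theorem freePar_gen (x : X) : freePar (K := K) p (freeGen p x) = sg K (p x) • freeGen p x :=
  freeLift_gen p _ _ x

theorem freePar_freePar (a : FreeCarrier K p) : freePar p (freePar p a) = a := by
  have : (freePar p).comp (freePar p) = AlgHom.id K (FreeCarrier K p) := by
    refine freeCarrier_algHom_ext p fun x => ?_
    rw [AlgHom.comp_apply, freePar_gen, map_smul, freePar_gen, smul_smul, sg_mul_self, one_smul]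
    rfl
  exact DFunLike.congr_fun this a

theorem freeGen_mul_eq (x : X) (b : FreeCarrier K p) :
    (p x = 0 → freeGen p x * b = b * freeGen p x) ∧
      (p x = 1 → freeGen p x * b = freePar p b * freeGen p x) := by
  induction b using freeCarrier_induction with
  | scalar c => exact ⟨fun _ => (Algebra.commutes c _).symm, fun _ => by
      rw [AlgHom.commutes]; exact (Algebra.commutes c _).symm⟩
  | gen y =>
    rw [freeGen_mul, freePar_gen]
    exact ⟨fun h => by rw [h]; simp, fun h => by rw [h, one_mul, smul_mul_assoc]⟩
  | mul a b ha hb =>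
    refine ⟨fun h => ?_, fun h => ?_⟩
    · rw [← mul_assoc, ha.1 h, mul_assoc, hb.1 h, mul_assoc]
    · rw [← mul_assoc, ha.2 h, mul_assoc, hb.2 h, map_mul, mul_assoc]
  | add a b ha hb =>
    refine ⟨fun h => ?_, fun h => ?_⟩
    · rw [mul_add, ha.1 h, hb.1 h, add_mul]
    · rw [mul_add, ha.2 h, hb.2 h, map_add, add_mul]

/-- The rules "even part central, odd part commuting up to parity" hold for scalars and generators
and survive sums and products. This yields the supercommutativity identity needed to build the
grading, before any grading is available. -/
theorem freeCarrier_exists_parts (a : FreeCarrier K p) : ∃ a₀ a₁, a = a₀ + a₁ ∧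
    freePar p a₀ = a₀ ∧ freePar p a₁ = -a₁ ∧ (∀ b, a₀ * b = b * a₀) ∧
      ∀ b, a₁ * b = freePar p b * a₁ := by
  induction a using freeCarrier_induction with
  | scalar c => exact ⟨_, 0, (add_zero _).symm, AlgHom.commutes _ _, by simp,
      Algebra.commutes c, by simp⟩
  | gen x =>
    have h := freeGen_mul_eq (K := K) p x
    rcases zmod_two_cases (p x) with hx | hx
    · exact ⟨_, 0, (add_zero _).symm, by rw [freePar_gen, hx, sg_zero, one_smul], by simp,
        fun b => (h b).1 hx, by simp⟩
    · exact ⟨0, _, (zero_add _).symm, by simp, by rw [freePar_gen, hx, sg_one, neg_smul, one_smul],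
        by simp, fun b => (h b).2 hx⟩
  | mul a b ha hb =>
    obtain ⟨a₀, a₁, rfl, h1, h2, h3, h4⟩ := ha
    obtain ⟨b₀, b₁, rfl, k1, k2, k3, k4⟩ := hb
    refine ⟨a₀ * b₀ + a₁ * b₁, a₀ * b₁ + a₁ * b₀, by simp only [mul_add, add_mul]; abel,
      by rw [map_add, map_mul, map_mul, h1, h2, k1, k2, neg_mul_neg],
      by rw [map_add, map_mul, map_mul, h1, h2, k1, k2, mul_neg, neg_mul, neg_add],
      fun c => ?_, fun c => ?_⟩
    · rw [add_mul, mul_add, mul_assoc, k3, ← mul_assoc, h3, mul_assoc a₁, k4, ← mul_assoc a₁, h4,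
        freePar_freePar, mul_assoc, mul_assoc]
    · rw [add_mul, mul_add, mul_assoc, k4, ← mul_assoc, h3, mul_assoc a₁, k3, ← mul_assoc a₁, h4,
        mul_assoc, mul_assoc]
  | add a b ha hb =>
    obtain ⟨a₀, a₁, rfl, h1, h2, h3, h4⟩ := ha
    obtain ⟨b₀, b₁, rfl, k1, k2, k3, k4⟩ := hb
    exact ⟨a₀ + b₀, a₁ + b₁, by abel, by rw [map_add, h1, k1], by rw [map_add, h2, k2, neg_add],
      fun c => by rw [add_mul, mul_add, h3, k3], fun c => by rw [add_mul, mul_add, h4, k4]⟩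

variable [NeZero (2 : K)]

/-- The free commutative superalgebra over `K` on generators with given parities. -/
def free : SAlg.{u} K :=
  ofInvolution (FreeCarrier K p) (freePar p) (freePar_freePar p) fun a b => by
    obtain ⟨a₀, a₁, rfl, h1, h2, h3, h4⟩ := freeCarrier_exists_parts p a
    rw [map_add, h1, h2, add_mul, h3, h4]
    simp only [mul_add, two_smul, mul_neg]
    abel

theorem freeGen_mem (x : X) : freeGen (K := K) p x ∈ (free p).grading (p x) := freePar_gen p x

/-- The morphism from the free superalgebra given by homogeneous images of the generators. -/
def freeDesc {S : SAlg.{u} K} (s : X → S) (hs : ∀ x, s x ∈ S.grading (p x)) : free p ⟶ S :=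
  homOfPar (A := free p) (freeLift p s fun x y => S.supercomm_smul (hs x) (hs y)) fun a => by
    have : (freeLift p s fun x y => S.supercomm_smul (hs x) (hs y)).comp (freePar p) =
        (S.par 1).toAlgHom.comp (freeLift p s fun x y => S.supercomm_smul (hs x) (hs y)) :=
      freeCarrier_algHom_ext p fun x => by
        rw [AlgHom.comp_apply, AlgHom.comp_apply, freePar_gen, map_smul, freeLift_gen,
          S.par_one_of_mem (hs x)]
    exact (congrArg _ (ofInvolution_par _ (freePar p) _ _ a)).trans (DFunLike.congr_fun this a)

theorem freeDesc_gen {S : SAlg.{u} K} (s : X → S) (hs : ∀ x, s x ∈ S.grading (p x)) (x : X) :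
    (freeDesc p s hs).toAlgHom (freeGen p x) = s x := 
  freeLift_gen p s (fun x y => S.supercomm_smul (hs x) (hs y)) x

theorem free_hom_ext {S : SAlg.{u} K} {f g : free p ⟶ S}
    (h : ∀ x, f.toAlgHom (freeGen p x) = g.toAlgHom (freeGen p x)) : f = g :=
  Hom.ext (freeCarrier_algHom_ext p h)

/-- The image of a generator in the free superalgebra over `R`. -/
def baseGen (R : SAlg.{u} K) (x : X) : tensor R (free p) := (inr R (free p)).toAlgHom (freeGen p x)

theorem desc_baseGen {R S : SAlg.{u} K} (f : R ⟶ S) (s : X → S) (hs : ∀ x, s x ∈ S.grading (p x))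
    (x : X) : (desc f (freeDesc p s hs)).toAlgHom (baseGen p R x) = s x :=
  (congrArg (fun h : free p ⟶ S => h.toAlgHom (freeGen p x)) (inr_desc f _)).trans
    (freeDesc_gen p s hs x)

theorem isFreeSuperalgebra_tensor (R : SAlg.{u} K) (m n : ℕ) :
    IsFreeSuperalgebra (inl R (free (Sum.elim (fun _ : Fin m => 0) fun _ : Fin n => 1)))
      (fun i => baseGen _ R (Sum.inl i)) (fun j => baseGen _ R (Sum.inr j)) where
  even i := (inr R _).map_mem _ _ (freeGen_mem _ (Sum.inl i))
  odd j := (inr R _).map_mem _ _ (freeGen_mem _ (Sum.inr j))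
  existsUnique_lift S f a b ha hb := by
    have hs : ∀ x, Sum.elim a b x ∈ S.grading (Sum.elim (fun _ => 0) (fun _ => 1) x) := by
      rintro (i | j)
      exacts [ha i, hb j]
    refine ⟨desc f (freeDesc _ (Sum.elim a b) hs), ⟨inl_desc _ _,
      fun i => desc_baseGen _ f _ hs (Sum.inl i), fun j => desc_baseGen _ f _ hs (Sum.inr j)⟩, ?_⟩
    rintro g ⟨h1, h2, h3⟩
    refine tensor_hom_ext (by rw [h1, inl_desc]) (free_hom_ext _ ?_)
    rw [inr_desc]
    rintro (i | j)
    · exact (h2 i).trans (freeDesc_gen _ _ hs (Sum.inl i)).symm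
    · exact (h3 j).trans (freeDesc_gen _ _ hs (Sum.inr j)).symm

/-- A submodule that contains `1` and is stable under the generators is everything. -/
theorem eq_top_of_baseGen_mul_mem (R : SAlg.{u} K) (V : Submodule K (tensor R (free p)))
    (h1 : 1 ∈ V) (hR : ∀ r, ∀ v ∈ V, (inl R (free p)).toAlgHom r * v ∈ V)
    (hX : ∀ x, ∀ v ∈ V, baseGen p R x * v ∈ V) : V = ⊤ := by
  have h : ∀ a : free p, ∀ v ∈ V, (inr R (free p)).toAlgHom a * v ∈ V := by
    intro a
    induction a using freeCarrier_induction with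
    | scalar c =>
      intro v hv
      rw [show (inr R (free p)).toAlgHom (algebraMap K (FreeCarrier K p) c) =
        algebraMap K _ c from (inr R (free p)).toAlgHom.commutes c, ← Algebra.smul_def]
      exact V.smul_mem c hv
    | gen x => exact hX x
    | mul a b ha hb =>
      intro v hv
      rw [show (inr R (free p)).toAlgHom (a * b) = _ from map_mul (inr R (free p)).toAlgHom a b,
        mul_assoc]
      exact ha _ (hb _ hv)
    | add a b ha hb =>
      intro v hv
      rw [show (inr R (free p)).toAlgHom (a + b) = _ from map_add (inr R (free p)).toAlgHom a b,
        add_mul]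
      exact V.add_mem (ha _ hv) (hb _ hv)
  refine eq_top_iff.mpr fun z _ => ?_
  induction z using tensor_induction with
  | tmul r a =>
    rw [← inl_mul_inr, ← mul_one (_ * _), mul_assoc]
    exact hR _ _ (h _ _ h1)
  | add x y hx hy => exact V.add_mem (hx trivial) (hy trivial)

end Free

/-! ### Finite presentation -/

theorem exists_homogeneousBasis_fin [NeZero (2 : K)] (A : SAlg.{u} K) [FiniteDimensional K A] :
    ∃ (m n : ℕ) (e : Module.Basis (Fin m ⊕ Fin n) K A),
      ∀ x, e x ∈ A.grading (Sum.elim (fun _ => 0) (fun _ => 1) x) := by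
  classical
  obtain ⟨ι, _, e, p, he⟩ := exists_homogeneousBasis A
  let ε : ι ≃ Fin (Fintype.card {i // p i = 0}) ⊕ Fin (Fintype.card {i // ¬ p i = 0}) :=
    (Equiv.sumCompl (fun i => p i = 0)).symm.trans
      (Equiv.sumCongr (Fintype.equivFin _) (Fintype.equivFin _))
  refine ⟨_, _, e.reindex ε, ?_⟩
  rintro (i | j)
  · rw [e.reindex_apply]
    have := he (ε.symm (Sum.inl i))
    rwa [show p (ε.symm (Sum.inl i)) = 0 from ((Fintype.equivFin {i // p i = 0}).symm i).2] at this
  · rw [e.reindex_apply]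
    have := he (ε.symm (Sum.inr j))
    have h1 : p (ε.symm (Sum.inr j)) = 1 := (zmod_two_cases _).resolve_left
      ((Fintype.equivFin {i // ¬ p i = 0}).symm j).2
    rwa [h1] at this

/-- A morphism between finite-dimensional superalgebras is finitely presented. -/
theorem isFinitelyPresented_of_finiteDimensional [NeZero (2 : K)] {R A : SAlg.{u} K}
    [FiniteDimensional K R] [FiniteDimensional K A] (ι : R ⟶ A) : IsFinitelyPresented ι := by
  obtain ⟨m, n, e, he⟩ := exists_homogeneousBasis_fin A
  let p : Fin m ⊕ Fin n → ZMod 2 := Sum.elim (fun _ => 0) fun _ => 1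
  let P := tensor R (free p)
  let π : P ⟶ A := desc ι (freeDesc p e he)
  have hπR : ∀ r, π.toAlgHom ((inl R (free p)).toAlgHom r) = ι.toAlgHom r := fun r => by
    rw [← hom_comp_apply, inl_desc]
  have hπX : ∀ x, π.toAlgHom (baseGen p R x) = e x := fun x =>
    desc_baseGen p ι e he x
  -- A linear section of π: the generators correspond to a homogeneous basis of A.
  let L : A →ₗ[K] P := e.constr K (baseGen p R)
  have hLe : ∀ x, L (e x) = baseGen p R x := fun x => e.constr_basis K _ x
  have hπL : ∀ a, π.toAlgHom (L a) = a := by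
    have : π.toAlgHom.toLinearMap ∘ₗ L = LinearMap.id := e.ext fun x => by
      rw [LinearMap.comp_apply, hLe]
      exact hπX x
    exact LinearMap.congr_fun this
  let b := Module.finBasis K R
  -- The relations are the multiplication table of A in the chosen basis, and the expression of a
  -- basis of R through the generators.
  let s : Set P := Set.range (fun xy : (Fin m ⊕ Fin n) × (Fin m ⊕ Fin n) =>
      baseGen p R xy.1 * baseGen p R xy.2 - L (e xy.1 * e xy.2)) ∪
    Set.range fun k => (inl R (free p)).toAlgHom (b k) - L (ι.toAlgHom (b k))
  have hs : s.Finite := (Set.finite_range _).union (Set.finite_range _)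
  let J : Ideal P := Ideal.span s
  have hJX : ∀ x y, baseGen p R x * baseGen p R y - L (e x * e y) ∈ J := fun x y =>
    Ideal.subset_span (Or.inl ⟨(x, y), rfl⟩)
  have hJR : ∀ r, (inl R (free p)).toAlgHom r - L (ι.toAlgHom r) ∈ J := fun r => by
    have : ∀ r, ((inl R (free p)).toAlgHom.toLinearMap - L ∘ₗ ι.toAlgHom.toLinearMap) r ∈
        J.restrictScalars K := by
      intro r
      rw [← b.sum_repr r, map_sum]
      refine Submodule.sum_mem _ fun k _ => ?_
      rw [map_smul]
      exact Submodule.smul_mem _ _ (Ideal.subset_span (Or.inr ⟨k, rfl⟩))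
    exact this r
  have hX : ∀ y, baseGen p R y ∈ P.grading (p y) := fun y =>
    (inr R _).map_mem _ _ (freeGen_mem p y)
  -- Modulo J every element is a linear combination of generators: V contains 1 and is stable under
  -- R and the generators, hence is everything. As π ∘ L = id, the kernel of π is exactly J.
  let V : Submodule K P := LinearMap.range L ⊔ J.restrictScalars K
  have hJV : ∀ v ∈ J, v ∈ V := fun v hv => Submodule.mem_sup_right hv
  have hLV : ∀ a, L a ∈ V := fun a => Submodule.mem_sup_left ⟨a, rfl⟩
  have hXL : ∀ x a, baseGen p R x * L a ∈ V := by
    intro x a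
    have : ∀ a, (LinearMap.mulLeft K (baseGen p R x) ∘ₗ L) a ∈ V := by
      intro a
      rw [← e.sum_repr a, map_sum]
      refine Submodule.sum_mem _ fun y _ => ?_
      rw [map_smul]
      refine Submodule.smul_mem _ _ ?_
      rw [LinearMap.comp_apply, hLe, LinearMap.mulLeft_apply,
        ← sub_add_cancel (_ * _) (L (e x * e y))]
      exact V.add_mem (hJV _ (hJX x y)) (hLV _)
    exact this a
  have hRL : ∀ r a, (inl R (free p)).toAlgHom r * L a ∈ V := by
    intro r a
    have : ∀ a, (LinearMap.mulLeft K ((inl R (free p)).toAlgHom r) ∘ₗ L) a ∈ V := by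
      intro a
      rw [← e.sum_repr a, map_sum]
      refine Submodule.sum_mem _ fun y _ => ?_
      rw [map_smul]
      refine Submodule.smul_mem _ _ ?_
      rw [LinearMap.comp_apply, hLe, LinearMap.mulLeft_apply, mul_eq_mul_par P (hX y), ← hom_par,
        ← sub_add_cancel ((inl R (free p)).toAlgHom _)
          (L (ι.toAlgHom ((R.par (p y)).toAlgHom r))), mul_add]
      exact V.add_mem (hJV _ (J.mul_mem_left _ (hJR _))) (hXL _ _)
    exact this a
  have hmul : ∀ c : P, (∀ a, c * L a ∈ V) → ∀ v ∈ V, c * v ∈ V := by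
    intro c hc v hv
    obtain ⟨_, ⟨a, rfl⟩, j, hj, rfl⟩ := Submodule.mem_sup.mp hv
    rw [mul_add]
    exact V.add_mem (hc a) (hJV _ (J.mul_mem_left c hj))
  have hV : V = ⊤ := by
    refine eq_top_of_baseGen_mul_mem p R V ?_ (fun r => hmul _ (hRL r)) fun x => hmul _ (hXL x)
    rw [← map_one (inl R (free p)).toAlgHom, ← sub_add_cancel ((inl R (free p)).toAlgHom 1)
      (L (ι.toAlgHom 1))]
    exact V.add_mem (hJV _ (hJR 1)) (hLV _)
  have hJker : J ≤ RingHom.ker π.toAlgHom := by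
    refine Ideal.span_le.mpr ?_
    rintro _ (⟨xy, rfl⟩ | ⟨k, rfl⟩)
    · refine (RingHom.mem_ker).mpr ?_
      simp only [map_sub, map_mul, hπX, hπL, sub_self]
    · refine (RingHom.mem_ker).mpr ?_
      simp only [map_sub, hπR, hπL, sub_self]
  have hker : RingHom.ker π.toAlgHom = J := by
    refine le_antisymm (fun v hv => ?_) hJker
    obtain ⟨_, ⟨a, rfl⟩, j, hj, rfl⟩ := Submodule.mem_sup.mp (hV ▸ Submodule.mem_top : v ∈ V)
    have hj0 : π.toAlgHom j = 0 := hJker hj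
    have h0 : π.toAlgHom (L a + j) = 0 := hv
    rw [map_add, hπL, hj0, add_zero] at h0
    rw [h0, map_zero, zero_add]
    exact hj
  refine ⟨m, n, P, inl R (free p), _, _, π, isFreeSuperalgebra_tensor R m n, inl_desc _ _,
    fun a => ⟨L a, hπL a⟩, ?_⟩
  rw [hker]
  exact Submodule.fg_span hs

end SAlg

end

/-- For a finite supergroup `G` over a field of characteristic not `2` and a closed supersubgroup
`H`, the canonical morphism from the naive quotient of `G` by `H` to the affine superscheme
`SSp K[G]^H` makes the latter both the quotient dur `K`-sheaf and the quotient `K`-sheaf. -/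
theorem theorem7p1 (K : Type u) [Field K] (hK : ringChar K ≠ 2)
    (G : AffineSupergroup.{u} K) (hG : G.IsFinite) (H : G.ClosedSubgroup) :
    IsAssociatedSheaf.{w, u} ffCoverings H.quotientMap ∧
      IsAssociatedSheaf.{w, u} fppfCoverings H.quotientMap := by
  have : NeZero (2 : K) := ⟨Ring.two_ne_zero hK⟩
  have : FiniteDimensional K G.coord := hG
  have : FiniteDimensional K H.invariants :=
    FiniteDimensional.finiteDimensional_submodule (Subalgebra.toSubmodule H.invariantSubalgebra)
  have hsheaf := SAlg.isSheafFor_SSp H.invariants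
  have hff := H.ffCoverings_invariantsIncl
  have horb := fun (T : SAlg.{u} K) (g g' : G.coord ⟶ T) => H.inv_mul_mem_points g g'
  -- An fppf-covering is in particular an ff-covering, so the sheaf property passes to the coarser
  -- notion; K[G] over K[G]^H is finitely presented by finite dimensionality.
  exact ⟨H.isAssociatedSheaf_quotientMap hsheaf hff horb,
    H.isAssociatedSheaf_quotientMap (fun R n S ι h => hsheaf R n S ι h.1)
      ⟨hff, fun _ => SAlg.isFinitelyPresented_of_finiteDimensional _⟩ horb⟩
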